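/- Let $C$ be a compact connected Riemann surface of genus $\ge 2$ and let $D\to C$ be a holomorphic fibre bundle with fibre the unit disc $\mathbb D=\{|\zeta|<1\}$ and with transition maps in $\mathrm{Aut}\,\mathbb D=\{\zeta\mapsto e^{i\theta}(\zeta-a)/(\bar a\zeta-1):\theta\in\mathbb R,\ |a|<1\}$ (these maps are then locally constant). Let $P\to C$ be the associated $\mathbb P^1$-bundle, glued by the same transition maps acting on $\mathbb P^1$, and regard $D$ as a subset of $P$. Let $s:C\to D$ be a harmonic section, i.e. a $C^2$ section whose expression $\zeta=h(z)$ in every local coordinate $z$ of $C$ and every fibre coordinate $\zeta$ of the bundle satisfies $h_{z\bar z}+\frac{2\bar h}{1-|h|^2}h_zh_{\bar z}=0$ (harmonicity with respect to the Poincaré metric of $\mathbb D$). Call $x\in C$ a critical point of $s$ if the real differential of $h$ at $x$ is not surjective, and suppose that $s$ has only finitely many critical points. Then: 1. there are a $C^2$ defining function $r$ of $D$ in $P$ (that is, $r$ is a real $C^2$ function on an open neighbourhood $U$ of $\overline D$ with $D=\{x\in U: r(x)<0\}$ and $dr\ne0$ on $\partial D$), a smooth Hermitian metric $g$ on $P$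 and a compact set $K\subset D$ such that the Levi form of $-\log(-r)$ is greater than $g$ (on all nonzero tangent vectors) at every point of $D\setminus K$; 2. in other words, $D$ is Takeuchi $1$-convex in $P$. Here a relatively compact domain $\Omega$ in an $n$-dimensional complex manifold $X$ is Takeuchi $q$-convex if it has a $C^2$ defining function $r$ such that, with respect to some Hermitian metric on $X$, at least $n-q+1$ eigenvalues of the Levi form of $-\log(-r)$ are greater than $1$ outside a compact subset of $\Omega$. -/

import Mathlib

open scoped Manifold ContDiff Topology ComplexConjugate
open Set

/-- The genus of a compact Riemann surface: the dimension of its space of holomorphic 1-forms. -/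
noncomputable def genus (C : Type*) [TopologicalSpace C] [ChartedSpace ℂ C]
    [IsManifold 𝓘(ℂ) ω C] : ℕ :=
  Module.finrank ℂ (ContMDiffSection 𝓘(ℂ) (ℂ →L[ℂ] ℂ) ω
    (fun x : C ↦ TangentSpace 𝓘(ℂ) x →L[ℂ] Bundle.Trivial C ℂ x))

section ComplexManifold

variable {E : Type*} [NormedAddCommGroup E] [NormedSpace ℂ E]
  {X : Type*} [TopologicalSpace X] [ChartedSpace E X]

/-- The real manifold underlying a complex manifold. -/
instance isManifold_real_of_complex [IsManifold 𝓘(ℂ, E) ω X] : IsManifold 𝓘(ℝ, E) ω X := by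
  apply isManifold_of_contDiffOn
  intro e e' he he'
  have h := (contDiffGroupoid ω 𝓘(ℂ, E)).compatible he he'
  rw [contDiffGroupoid, mem_groupoid_of_pregroupoid] at h
  exact h.1.restrict_scalars ℝ

variable (E X) in
/-- A smooth Hermitian metric on a complex manifold, given by its real part: a smooth Riemannian
metric that is invariant under multiplication by `i`. -/
structure HermitianMetric [IsManifold 𝓘(ℂ, E) ω X] extends
    Bundle.ContMDiffRiemannianMetric 𝓘(ℝ, E) ∞ E (fun x : X ↦ TangentSpace 𝓘(ℝ, E) x) where
  inner_I : ∀ (x : X) (v w : E), inner x (Complex.I • v : E) (Complex.I • w : E) = inner x v w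

/-- The (real part of the) Levi form `∑ u_{j k̄} v_j conj(w_k)` of a real `C²` function `u` at `p`,
on tangent vectors at `p`, which are represented by their coordinates in the preferred chart. It is
a quarter of `D²u(v, w) + D²u(iv, iw)`. -/
noncomputable def leviForm (u : X → ℝ) (p : X) (v w : E) : ℝ :=
  (fderiv ℝ (fderiv ℝ (u ∘ (chartAt E p).symm)) (chartAt E p p) v w +
    fderiv ℝ (fderiv ℝ (u ∘ (chartAt E p).symm)) (chartAt E p p)
      (Complex.I • v) (Complex.I • w)) / 4

variable (E) in
/-- `r` is a `C²` defining function of the open set `Ω`: it is defined and `C²` on an open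
neighbourhood `U` of the closure of `Ω`, where `Ω = {r < 0}`, and `dr ≠ 0` on the boundary. -/
def IsDefiningFunction (Ω : Set X) (r : X → ℝ) : Prop :=
  ∃ U : Set X, IsOpen U ∧ closure Ω ⊆ U ∧ ContMDiffOn 𝓘(ℝ, E) 𝓘(ℝ, ℝ) 2 r U ∧
    Ω = {x | x ∈ U ∧ r x < 0} ∧ ∀ x ∈ frontier Ω, mfderiv 𝓘(ℝ, E) 𝓘(ℝ, ℝ) r x ≠ 0

variable (E) in
/-- Takeuchi `q`-convexity of a relatively compact domain `Ω` with `C²` boundary in a complex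
manifold of dimension `n`: for some `C²` defining function `r` and some Hermitian metric `g`,
at least `n - q + 1` eigenvalues (with multiplicity) with respect to `g` of the Levi form of
`-log (-r)` are greater than `1` outside a compact subset of `Ω`. -/
def TakeuchiConvex [IsManifold 𝓘(ℂ, E) ω X] (q : ℕ) (Ω : Set X) : Prop :=
  IsOpen Ω ∧ IsConnected Ω ∧ IsCompact (closure Ω) ∧
    ∃ r : X → ℝ, IsDefiningFunction E Ω r ∧ ∃ g : HermitianMetric E X,
      ∃ K : Set X, IsCompact K ∧ K ⊆ Ω ∧ ∀ p ∈ Ω \ K,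
        ∃ v : Fin (Module.finrank ℂ E + 1 - q) → E, LinearIndependent ℂ v ∧
          ∀ j, ∃ c : ℝ, 1 < c ∧ ∀ w : E,
            leviForm (fun x ↦ -Real.log (-r x)) p (v j) w = c * g.inner p (v j) w

end ComplexManifold

/-- The Wirtinger derivative `∂f/∂z`. -/
noncomputable def wirtinger (f : ℂ → ℂ) (z : ℂ) : ℂ :=
  (fderiv ℝ f z 1 - Complex.I * fderiv ℝ f z Complex.I) / 2

/-- The Wirtinger derivative `∂f/∂z̄`. -/
noncomputable def wirtingerBar (f : ℂ → ℂ) (z : ℂ) : ℂ :=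
  (fderiv ℝ f z 1 + Complex.I * fderiv ℝ f z Complex.I) / 2

/-! The Riemann sphere is `OnePoint ℂ`, on which Mathlib lets `GL (Fin 2) ℂ` act by Moebius
transformations. -/

/-- The affine coordinate on the Riemann sphere (with the irrelevant value `0` at infinity). -/
noncomputable def affineCoord (w : OnePoint ℂ) : ℂ := w.elim 0 id

/-- `φ` is the self-map of the Riemann sphere induced by an automorphism of the unit disc,
`ζ ↦ e^{it} (ζ - a) / (conj a * ζ - 1)` with `t` real and `|a| < 1`. -/
def IsDiscAut (φ : OnePoint ℂ → OnePoint ℂ) : Prop :=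
  ∃ (A : GL (Fin 2) ℂ) (t : ℝ) (a : ℂ), ‖a‖ < 1 ∧
    (A : Matrix (Fin 2) (Fin 2) ℂ) =
      !![Complex.exp (t * Complex.I), -(Complex.exp (t * Complex.I) * a); conj a, -1] ∧
    ∀ w, φ w = A • w

theorem eq_of_differentiableOn_conj {f : ℂ → ℂ} {s : Set ℂ} (hs : IsOpen s)
    (hs' : IsPreconnected s) (hf : DifferentiableOn ℂ f s)
    (hf' : DifferentiableOn ℂ (fun z ↦ conj (f z)) s) {x y : ℂ} (hx : x ∈ s) (hy : y ∈ s) :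
    f x = f y := by
  refine hs.is_const_of_deriv_eq_zero hs' hf (fun z hz ↦ ?_) hx hy
  have h1 := (hf.differentiableAt (hs.mem_nhds hz)).hasDerivAt
  have h2 := (hf'.differentiableAt (hs.mem_nhds hz)).hasDerivAt
  have h3 : HasFDerivAt f _ z := h1.hasFDerivAt.restrictScalars ℝ
  have h4 := (Complex.conjCLE.toContinuousLinearMap.hasFDerivAt (x := f z)).comp z h3
  have h5 := (h2.hasFDerivAt.restrictScalars ℝ).unique h4
  have e1 := DFunLike.congr_fun h5 1
  have e2 := DFunLike.congr_fun h5 Complex.I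
  simp at e1 e2
  rw [e1] at e2
  have : 2 * Complex.I * conj (deriv f z) = 0 := by linear_combination e2
  simpa using this

theorem continuous_smul_onePoint (A : GL (Fin 2) ℂ) :
    Continuous (fun w : OnePoint ℂ ↦ A • w) := by
  have haff (a b : ℂ) (ha : a ≠ 0) :
      Continuous (OnePoint.map (fun z : ℂ ↦ a * z + b)) :=
    (((Homeomorph.mulLeft₀ a ha).trans (Homeomorph.addRight b)).onePointCongr).continuous
  let inv : OnePoint ℂ → OnePoint ℂ := fun w ↦
    w.elim ((0 : ℂ) : OnePoint ℂ) (fun z ↦ if z = 0 then OnePoint.infty else ((z⁻¹ : ℂ) : OnePoint ℂ))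
  have hinv : Continuous inv := by
    rw [OnePoint.continuous_iff]
    constructor
    · show Filter.Tendsto (fun z : ℂ ↦ if z = 0 then OnePoint.infty else ((z⁻¹ : ℂ) : OnePoint ℂ))
        (Filter.coclosedCompact ℂ) (𝓝 ((0 : ℂ) : OnePoint ℂ))
      rw [Filter.coclosedCompact_eq_cocompact, ← Metric.cobounded_eq_cocompact]
      refine ((OnePoint.continuous_coe.tendsto _).comp
        (Filter.tendsto_inv₀_cobounded (α := ℂ))).congr' ?_
      filter_upwards [(Metric.cobounded_eq_cocompact (α := ℂ)).symm ▸
        (isCompact_singleton (x := (0 : ℂ))).compl_mem_cocompact] with z hz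
      have hz' : z ≠ 0 := hz
      simp [hz']
    · show Continuous (fun z : ℂ ↦ if z = 0 then OnePoint.infty else ((z⁻¹ : ℂ) : OnePoint ℂ))
      rw [continuous_iff_continuousAt]
      intro z
      by_cases hz : z = 0
      · subst hz
        rw [continuousAt_iff_punctured_nhds]
        simp only [if_true]
        refine Filter.Tendsto.congr' (f₁ := fun z : ℂ ↦ ((z⁻¹ : ℂ) : OnePoint ℂ)) ?_ ?_
        · filter_upwards [self_mem_nhdsWithin] with z hz
          have hz' : z ≠ 0 := hz
          rw [if_neg hz']
        · have h := OnePoint.tendsto_coe_infty (X := ℂ)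
          rw [Filter.coclosedCompact_eq_cocompact, ← Metric.cobounded_eq_cocompact] at h
          exact h.comp Filter.tendsto_inv₀_nhdsNE_zero
      · refine ContinuousAt.congr (f := fun z : ℂ ↦ ((z⁻¹ : ℂ) : OnePoint ℂ)) ?_ ?_
        · exact OnePoint.continuous_coe.continuousAt.comp (continuousAt_inv₀ hz)
        · filter_upwards [isOpen_ne.mem_nhds hz] with w hw
          rw [if_neg hw]
  have hdet : A 0 0 * A 1 1 - A 0 1 * A 1 0 ≠ 0 := by
    have := A.det_ne_zero
    rwa [Matrix.det_fin_two] at this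
  by_cases hc : A 1 0 = 0
  · have ha : A 0 0 ≠ 0 := fun h ↦ hdet (by simp [h, hc])
    have hd : A 1 1 ≠ 0 := fun h ↦ hdet (by simp [h, hc])
    convert haff (A 0 0 / A 1 1) (A 0 1 / A 1 1) (div_ne_zero ha hd) using 2 with w
    induction w using OnePoint.rec with
    | infty => simp [OnePoint.smul_infty_eq_ite, hc]
    | coe z =>
      simp only [OnePoint.smul_some_eq_ite, hc, zero_mul, zero_add, hd, if_false,
        OnePoint.map_some]
      congr 1
      field_simp
  · have hk : (A 0 1 * A 1 0 - A 0 0 * A 1 1) / A 1 0 ≠ 0 :=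
      div_ne_zero (fun h ↦ hdet (by linear_combination -h)) hc
    convert (haff ((A 0 1 * A 1 0 - A 0 0 * A 1 1) / A 1 0) (A 0 0 / A 1 0) hk).comp
      (hinv.comp (haff (A 1 0) (A 1 1) hc)) using 2 with w
    induction w using OnePoint.rec with
    | infty => simp [OnePoint.smul_infty_eq_ite, hc, inv]
    | coe z =>
      by_cases hz : A 1 0 * z + A 1 1 = 0
      · simp [OnePoint.smul_some_eq_ite, hz, inv]
      · simp only [OnePoint.smul_some_eq_ite, hz, if_false, inv, Function.comp,
          OnePoint.map_some, OnePoint.elim_some]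
        congr 1
        rw [div_eq_iff hz, add_mul, mul_assoc, inv_mul_cancel₀ hz]
        field_simp
        ring

/-- A family of disc automorphisms whose orbit maps are holomorphic in the parameter is
constant on connected parameter sets. -/
theorem IsDiscAut.eq_of_holomorphic {s : Set ℂ} (hs : IsOpen s)
    (hs' : IsPreconnected s) {g : ℂ → OnePoint ℂ → OnePoint ℂ}
    (hg : ∀ x ∈ s, IsDiscAut (g x))
    (hol : ∀ ζ : ℂ, ‖ζ‖ < 1 → DifferentiableOn ℂ (fun x ↦ affineCoord (g x ζ)) s)
    {x y : ℂ} (hx : x ∈ s) (hy : y ∈ s) : g x = g y := by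
  choose! A t a ha hA hgA using hg
  have hne : ∀ x ∈ s, ∀ ζ : ℂ, ‖ζ‖ < 1 → conj (a x) * ζ - 1 ≠ 0 := by
    intro x hx ζ hζ h
    have h1 : conj (a x) * ζ = 1 := by linear_combination h
    have h2 := congrArg norm h1
    rw [norm_mul, RCLike.norm_conj, norm_one] at h2
    nlinarith [norm_nonneg ζ, norm_nonneg (a x), ha x hx]
  have hval : ∀ x ∈ s, ∀ ζ : ℂ, ‖ζ‖ < 1 → affineCoord (g x ζ) * (conj (a x) * ζ - 1)
      = Complex.exp (t x * Complex.I) * ζ - Complex.exp (t x * Complex.I) * a x := by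
    intro x hx ζ hζ
    have h0 := hne x hx ζ hζ
    have h0' : ¬ (conj (a x) * ζ + -1 = 0) := by rwa [← sub_eq_add_neg]
    rw [hgA x hx, OnePoint.smul_some_eq_ite, hA x hx]
    simp [h0', affineCoord]
    rw [← sub_eq_add_neg, ← sub_eq_add_neg, div_mul_cancel₀ _ h0]
  have n0 : ‖(0 : ℂ)‖ < 1 := by simp
  have n1 : ‖(1 / 2 : ℂ)‖ < 1 := by norm_num
  have n2 : ‖(-1 / 2 : ℂ)‖ < 1 := by norm_num
  set G0 := fun x ↦ affineCoord (g x (0 : ℂ)) with hG0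
  set G1 := fun x ↦ affineCoord (g x (1 / 2 : ℂ)) with hG1
  set G2 := fun x ↦ affineCoord (g x (-1 / 2 : ℂ)) with hG2
  have e0 : ∀ x ∈ s, G0 x = Complex.exp (t x * Complex.I) * a x := by
    intro x hx
    linear_combination -(hval x hx 0 n0)
  have e1 : ∀ x ∈ s, G1 x * (conj (a x) * (1 / 2) - 1) =
      Complex.exp (t x * Complex.I) * (1 / 2) - G0 x := by
    intro x hx
    rw [e0 x hx]; exact hval x hx _ n1
  have e2 : ∀ x ∈ s, G2 x * (conj (a x) * (-1 / 2) - 1) =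
      Complex.exp (t x * Complex.I) * (-1 / 2) - G0 x := by
    intro x hx
    rw [e0 x hx]; exact hval x hx _ n2
  have h12 : ∀ x ∈ s, G2 x - G1 x ≠ 0 := by
    intro x hx h
    have hG : G2 x = G1 x := by linear_combination h
    have f1 := e1 x hx
    have f2 := e2 x hx
    rw [hG] at f2
    have f3 : G1 x * conj (a x) = Complex.exp (t x * Complex.I) := by linear_combination f1 - f2
    have f4 : G1 x = G0 x := by linear_combination -(1 / 2) * f1 - (1 / 2) * f2
    rw [f4, e0 x hx] at f3
    have f5 := congrArg norm f3
    rw [norm_mul, norm_mul, RCLike.norm_conj, Complex.norm_exp_ofReal_mul_I] at f5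
    nlinarith [norm_nonneg (a x), ha x hx]
  have d0 := hol _ n0
  have d1 := hol _ n1
  have d2 := hol _ n2
  have da' : DifferentiableOn ℂ (fun x ↦ conj (a x)) s := by
    refine DifferentiableOn.congr (f := fun x ↦ (2 * (G0 x - G1 x) + 2 * (G0 x - G2 x))
      / (G2 x - G1 x)) (by fun_prop (disch := assumption)) ?_
    intro x hx
    rw [eq_div_iff (h12 x hx)]
    linear_combination -2 * e1 x hx - 2 * e2 x hx
  have du : DifferentiableOn ℂ (fun x ↦ Complex.exp (t x * Complex.I)) s := by
    refine DifferentiableOn.congr (f := fun x ↦ 2 * (G0 x - G1 x) + conj (a x) * G1 x)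
      (by fun_prop) ?_
    intro x hx
    linear_combination -2 * e1 x hx
  have hu := eq_of_differentiableOn_conj hs hs' du (by
    refine DifferentiableOn.congr (f := fun x ↦ (Complex.exp (t x * Complex.I))⁻¹)
      (du.inv fun x _ ↦ Complex.exp_ne_zero _) ?_
    intro x hx
    rw [← Complex.exp_conj, ← Complex.exp_neg]
    simp) hx hy
  have da : DifferentiableOn ℂ a s := by
    refine DifferentiableOn.congr (f := fun x ↦ G0 x / Complex.exp (t x * Complex.I))
      (d0.div du fun x _ ↦ Complex.exp_ne_zero _) ?_
    intro x hx
    rw [e0 x hx]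
    field_simp [Complex.exp_ne_zero]
  have haa := eq_of_differentiableOn_conj hs hs' da da' hx hy
  have hAA : A x = A y := by
    apply Units.ext
    rw [hA x hx, hA y hy, haa]
    rw [hu]
  funext w
  rw [hgA x hx, hgA y hy, hAA]

/-- The identity and the matrix of `ζ ↦ 1 / ζ`. -/
noncomputable def sphereMatrix : Bool → GL (Fin 2) ℂ
  | false => 1
  | true => Matrix.GeneralLinearGroup.mkOfDetNeZero !![0, 1; 1, 0] (by simp)

/-- A Moebius transformation as a homeomorphism of the sphere. -/
noncomputable def smulHomeo (A : GL (Fin 2) ℂ) : OnePoint ℂ ≃ₜ OnePoint ℂ where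
  toEquiv := MulAction.toPerm A
  continuous_toFun := continuous_smul_onePoint A
  continuous_invFun := continuous_smul_onePoint A⁻¹

/-- The affine chart of the Riemann sphere. -/
noncomputable def affineChart : OpenPartialHomeomorph (OnePoint ℂ) ℂ where
  toFun := affineCoord
  invFun z := z
  source := {OnePoint.infty}ᶜ
  target := univ
  map_source' _ _ := mem_univ _
  map_target' z _ := OnePoint.coe_ne_infty z
  left_inv' w hw := by
    induction w using OnePoint.rec with
    | infty => exact absurd rfl hw
    | coe z => rfl
  right_inv' _ _ := rfl
  open_source := OnePoint.isClosed_infty.isOpen_compl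
  open_target := isOpen_univ
  continuousOn_toFun := by
    intro w hw
    induction w using OnePoint.rec with
    | infty => exact absurd rfl hw
    | coe z =>
      have h : ContinuousAt (affineCoord ∘ ((↑) : ℂ → OnePoint ℂ)) z := continuousAt_id
      exact (OnePoint.continuousAt_coe.2 h).continuousWithinAt
  continuousOn_invFun := OnePoint.continuous_coe.continuousOn

/-- The two standard charts of the Riemann sphere: `ζ` (off infinity) and `1 / ζ` (off `0`). -/
noncomputable def sphereChart (b : Bool) : OpenPartialHomeomorph (OnePoint ℂ) ℂ :=
  (smulHomeo (sphereMatrix b)).toOpenPartialHomeomorph ≫ₕ affineChart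

open Classical in
theorem mem_sphereChart_source (w : OnePoint ℂ) :
    w ∈ (sphereChart (decide (w = OnePoint.infty))).source := by
  by_cases hw : w = OnePoint.infty
  · subst hw
    simp [sphereChart, affineChart, smulHomeo, sphereMatrix, OnePoint.smul_infty_eq_ite]
  · simp [sphereChart, affineChart, smulHomeo, sphereMatrix, hw]

theorem contDiffAt_affineCoord_smul (A : GL (Fin 2) ℂ) {z : ℂ}
    (hz : A • (z : OnePoint ℂ) ≠ OnePoint.infty) :
    ContDiffAt ℂ ω (fun z : ℂ ↦ affineCoord (A • (z : OnePoint ℂ))) z := by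
  have h0 : A 1 0 * z + A 1 1 ≠ 0 := by
    intro h
    exact hz (by rw [OnePoint.smul_some_eq_ite, if_pos h])
  have h1 : ContDiffAt ℂ ω (fun z : ℂ ↦ (A 0 0 * z + A 0 1) / (A 1 0 * z + A 1 1)) z :=
    ((contDiffAt_const.mul contDiffAt_id).add contDiffAt_const).div
      ((contDiffAt_const.mul contDiffAt_id).add contDiffAt_const) h0
  refine h1.congr_of_eventuallyEq ?_
  have h2 : ContinuousAt (fun z : ℂ ↦ A 1 0 * z + A 1 1) z := by fun_prop
  filter_upwards [h2.eventually_ne h0] with w hw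
  rw [OnePoint.smul_some_eq_ite, if_neg hw]
  rfl

/-- A holomorphic fibre bundle over `C` whose fibre is the unit disc and whose structure group is
the automorphism group of the disc, given by an open covering and its transition maps
`trans i j x` (from the coordinate over `baseSet i` to the one over `baseSet j`). The maps are
disc automorphisms, written as maps of the whole sphere, and depend holomorphically on `x`. -/
structure DiscBundle (ι : Type*) (C : Type*) [TopologicalSpace C] [ChartedSpace ℂ C] where
  baseSet : ι → Set C
  isOpen_baseSet : ∀ i, IsOpen (baseSet i)
  indexAt : C → ι
  mem_baseSet_at : ∀ x, x ∈ baseSet (indexAt x)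
  trans : ι → ι → C → OnePoint ℂ → OnePoint ℂ
  trans_self : ∀ i, ∀ x ∈ baseSet i, ∀ w, trans i i x w = w
  trans_comp : ∀ i j k, ∀ x ∈ baseSet i ∩ baseSet j ∩ baseSet k, ∀ w,
    trans j k x (trans i j x w) = trans i k x w
  isDiscAut : ∀ i j, ∀ x ∈ baseSet i ∩ baseSet j, IsDiscAut (trans i j x)
  holomorphic : ∀ i j, ∀ ζ : ℂ, ‖ζ‖ < 1 →
    MDifferentiableOn 𝓘(ℂ) 𝓘(ℂ) (fun x ↦ affineCoord (trans i j x ζ)) (baseSet i ∩ baseSet j)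

namespace DiscBundle

variable {ι : Type*} {C : Type*} [TopologicalSpace C] [ChartedSpace ℂ C]

/-- The transition maps are locally constant. -/
theorem eventually_trans_eq [IsManifold 𝓘(ℂ) ω C] (B : DiscBundle ι C) (i j : ι) {x : C}
    (hx : x ∈ B.baseSet i ∩ B.baseSet j) :
    ∀ᶠ y in 𝓝 x, B.trans i j y = B.trans i j x := by
  have hU : IsOpen (B.baseSet i ∩ B.baseSet j) :=
    (B.isOpen_baseSet i).inter (B.isOpen_baseSet j)
  set e := chartAt ℂ x with he
  have hV : IsOpen (e.target ∩ e.symm ⁻¹' (B.baseSet i ∩ B.baseSet j)) :=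
    e.isOpen_inter_preimage_symm hU
  have hxV : e x ∈ e.target ∩ e.symm ⁻¹' (B.baseSet i ∩ B.baseSet j) := by
    refine ⟨e.map_source (mem_chart_source ℂ x), ?_⟩
    rw [mem_preimage, e.left_inv (mem_chart_source ℂ x)]
    exact hx
  obtain ⟨ε, hε, hball⟩ := Metric.isOpen_iff.1 hV _ hxV
  have key : ∀ z ∈ Metric.ball (e x) ε,
      B.trans i j (e.symm z) = B.trans i j (e.symm (e x)) := by
    intro z hz
    refine IsDiscAut.eq_of_holomorphic (g := fun z ↦ B.trans i j (e.symm z))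
      Metric.isOpen_ball (convex_ball (e x) ε).isPreconnected
      (fun z hz ↦ B.isDiscAut i j _ (hball hz).2) (fun ζ hζ ↦ ?_) hz (Metric.mem_ball_self hε)
    rw [← mdifferentiableOn_iff_differentiableOn]
    exact (B.holomorphic i j ζ hζ).comp
      ((mdifferentiableOn_atlas_symm (I := 𝓘(ℂ)) (chart_mem_atlas ℂ x)).mono fun z hz ↦ (hball hz).1)
      (fun z hz ↦ (hball hz).2)
  have hcont : ContinuousAt e x := e.continuousAt (mem_chart_source ℂ x)
  filter_upwards [hcont (Metric.ball_mem_nhds _ hε),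
    e.open_source.mem_nhds (mem_chart_source ℂ x)] with y hy hys
  have := key (e y) hy
  rwa [e.left_inv hys, e.left_inv (mem_chart_source ℂ x)] at this

variable [IsManifold 𝓘(ℂ) ω C]

/-- The gluing data of the associated bundle of Riemann spheres. -/
def toCore (B : DiscBundle ι C) : FiberBundleCore ι C (OnePoint ℂ) where
  baseSet := B.baseSet
  isOpen_baseSet := B.isOpen_baseSet
  indexAt := B.indexAt
  mem_baseSet_at := B.mem_baseSet_at
  coordChange := B.trans
  coordChange_self := B.trans_self
  continuousOn_coordChange := by
    rintro i j ⟨x, w⟩ ⟨hx, -⟩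
    obtain ⟨A, t, a, -, -, hA⟩ := B.isDiscAut i j x hx
    refine ContinuousAt.continuousWithinAt ?_
    refine ContinuousAt.congr (f := fun p : C × OnePoint ℂ ↦ A • p.2)
      ((continuous_smul_onePoint A).comp continuous_snd).continuousAt ?_
    filter_upwards [continuousAt_fst (B.eventually_trans_eq i j hx)] with p hp
    have hp' : B.trans i j p.1 = B.trans i j x := hp
    rw [hp', hA]
  coordChange_comp := B.trans_comp

/-- The total space `P` of the associated `ℙ¹`-bundle, glued from the `baseSet i × ℙ¹` by the
transition maps of the disc bundle. -/
abbrev P (B : DiscBundle ι C) : Type _ := B.toCore.TotalSpace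

/-- The bundle projection `P → C`. -/
def proj (B : DiscBundle ι C) (p : B.P) : C := Bundle.TotalSpace.proj p

/-- The fibre coordinate of the trivialization of `P` over `baseSet i`. -/
noncomputable def fibreCoord (B : DiscBundle ι C) (i : ι) (p : B.P) : OnePoint ℂ :=
  (B.toCore.localTriv i p).2

/-- The chart of `P` made of a local trivialization, a chart of `C` and a chart of the sphere. -/
noncomputable def chart (B : DiscBundle ι C) (i : ι) (e : OpenPartialHomeomorph C ℂ) (b : Bool) :
    OpenPartialHomeomorph B.P (ℂ × ℂ) :=
  (B.toCore.localTriv i).toOpenPartialHomeomorph ≫ₕ (e.prod (sphereChart b))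

open Classical in
noncomputable instance (B : DiscBundle ι C) : ChartedSpace (ℂ × ℂ) B.P where
  atlas := {φ | ∃ i, ∃ e ∈ atlas ℂ C, ∃ b, φ = B.chart i e b}
  chartAt p := B.chart (B.indexAt (B.proj p)) (chartAt ℂ (B.proj p))
    (decide (B.fibreCoord (B.indexAt (B.proj p)) p = OnePoint.infty))
  mem_chart_source p := by
    rw [chart, OpenPartialHomeomorph.trans_source]
    refine ⟨?_, ?_⟩
    · exact (Bundle.Trivialization.mem_source _).2 (B.mem_baseSet_at (B.proj p))
    · refine ⟨mem_chart_source ℂ (B.proj p), ?_⟩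
      exact mem_sphereChart_source (B.fibreCoord (B.indexAt (B.proj p)) p)
  chart_mem_atlas p := ⟨_, _, chart_mem_atlas ℂ _, _, rfl⟩

instance (B : DiscBundle ι C) : IsManifold 𝓘(ℂ, ℂ × ℂ) ω B.P := by
  apply isManifold_of_contDiffOn
  rintro _ _ ⟨i, e, he, b, rfl⟩ ⟨j, e', he', b', rfl⟩
  rintro ⟨z, ζ⟩ ⟨hz, -⟩
  refine ContDiffAt.contDiffWithinAt ?_
  have hz' : (z, ζ) ∈ ((B.chart i e b).symm ≫ₕ B.chart j e' b').source := hz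
  have hez : z ∈ e.target := hz'.1.1.1
  have hi : e.symm z ∈ B.baseSet i := hz'.1.2.1
  have hj : e.symm z ∈ B.baseSet j := hz'.2.1
  have he'z : e.symm z ∈ e'.source := hz'.2.2.1
  have hS : ∀ w : ℂ, (sphereChart b).symm w = (sphereMatrix b)⁻¹ • (w : OnePoint ℂ) :=
    fun w ↦ rfl
  have hS' : ∀ w : OnePoint ℂ, sphereChart b' w = affineCoord (sphereMatrix b' • w) :=
    fun w ↦ rfl
  obtain ⟨A, t, a, -, -, hA⟩ := B.isDiscAut i j _ ⟨hi, hj⟩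
  have htr : ∀ y ∈ B.baseSet i ∩ B.baseSet j, ∀ w,
      B.trans (B.indexAt y) j y (B.trans i (B.indexAt y) y w) = B.trans i j y w :=
    fun y hy w ↦ B.trans_comp i (B.indexAt y) j y ⟨⟨hy.1, B.mem_baseSet_at y⟩, hy.2⟩ w
  have hfin : (sphereMatrix b' * A * (sphereMatrix b)⁻¹) • (ζ : OnePoint ℂ)
      ≠ OnePoint.infty := by
    have h1 : B.trans (B.indexAt (e.symm z)) j (e.symm z)
        (B.trans i (B.indexAt (e.symm z)) (e.symm z) ((sphereChart b).symm ζ)) ∈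
        (sphereChart b').source := hz'.2.2.2
    rw [htr _ ⟨hi, hj⟩, hA, hS] at h1
    rw [mul_smul, mul_smul]
    exact h1.2
  have hsm : ContDiffAt ℂ ω (e' ∘ e.symm) z := by
    have h := (contDiffGroupoid ω 𝓘(ℂ)).compatible he he'
    rw [contDiffGroupoid, mem_groupoid_of_pregroupoid] at h
    have h' : ContDiffOn ℂ ω (e' ∘ e.symm) ((e.symm ≫ₕ e').source) := by
      simpa [contDiffPregroupoid] using h.1
    exact h'.contDiffAt ((e.symm ≫ₕ e').open_source.mem_nhds ⟨hez, he'z⟩)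
  have hmain : ContDiffAt ℂ ω (fun q : ℂ × ℂ ↦ ((e' ∘ e.symm) q.1,
      affineCoord ((sphereMatrix b' * A * (sphereMatrix b)⁻¹) • (q.2 : OnePoint ℂ)))) (z, ζ) :=
    (ContDiffAt.comp (z, ζ) (f := Prod.fst) hsm contDiffAt_fst).prodMk
      (ContDiffAt.comp (z, ζ) (f := Prod.snd) (contDiffAt_affineCoord_smul _ hfin)
        contDiffAt_snd)
  refine hmain.congr_of_eventuallyEq ?_
  have hc : ContinuousAt e.symm z := e.continuousAt_symm hez
  have hev : ∀ᶠ y in 𝓝 z, e.symm y ∈ B.baseSet i ∩ B.baseSet j ∧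
      B.trans i j (e.symm y) = B.trans i j (e.symm z) :=
    (hc.eventually (((B.isOpen_baseSet i).inter (B.isOpen_baseSet j)).mem_nhds ⟨hi, hj⟩)).and
      (hc.eventually (B.eventually_trans_eq i j ⟨hi, hj⟩))
  have hev2 : ∀ᶠ q : ℂ × ℂ in 𝓝 (z, ζ), e.symm q.1 ∈ B.baseSet i ∩ B.baseSet j ∧
      B.trans i j (e.symm q.1) = B.trans i j (e.symm z) :=
    (continuous_fst.continuousAt (x := ((z, ζ) : ℂ × ℂ))).eventually hev
  filter_upwards [hev2] with q hq
  show (e' (e.symm q.1), sphereChart b' (B.trans (B.indexAt (e.symm q.1)) j (e.symm q.1)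
        (B.trans i (B.indexAt (e.symm q.1)) (e.symm q.1) ((sphereChart b).symm q.2)))) = _
  rw [htr _ hq.1, hq.2, hA, hS, hS', mul_smul, mul_smul]
  rfl

/-- The disc bundle `D` as a subset of `P`: the points whose fibre coordinate lies in the unit
disc. -/
def D (B : DiscBundle ι C) : Set B.P :=
  {p | ∃ ζ : ℂ, ‖ζ‖ < 1 ∧ B.fibreCoord (B.indexAt (B.proj p)) p = (ζ : OnePoint ℂ)}

/-- `s` is a section of `D → C`. -/
def IsSection (B : DiscBundle ι C) (s : C → B.P) : Prop :=
  ∀ x, B.proj (s x) = x ∧ s x ∈ B.D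

/-- The local expression `h` of `s` in the fibre coordinate over `baseSet i` and in the local
coordinate `e` of `C`. -/
noncomputable def localRep (B : DiscBundle ι C) (s : C → B.P) (i : ι)
    (e : OpenPartialHomeomorph C ℂ) (z : ℂ) : ℂ :=
  affineCoord (B.fibreCoord i (s (e.symm z)))

/-- `s` is a harmonic section of `D → C`: a `C²` section whose local expressions `h` are harmonic
maps into the disc with the Poincare metric `|dζ|² / (1 - |ζ|²)²`, that is,
`h_{z z̄} + 2 conj(h) h_z h_{z̄} / (1 - |h|²) = 0`. -/
def IsHarmonicSection (B : DiscBundle ι C) (s : C → B.P) : Prop :=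
  B.IsSection s ∧ ∀ i, ∀ e ∈ atlas ℂ C,
    ContDiffOn ℝ 2 (B.localRep s i e) (e.target ∩ e.symm ⁻¹' B.baseSet i) ∧
    ∀ z ∈ e.target ∩ e.symm ⁻¹' B.baseSet i,
      wirtinger (wirtingerBar (B.localRep s i e)) z +
        2 * conj (B.localRep s i e z) / (1 - (‖B.localRep s i e z‖ : ℂ) ^ 2) *
          wirtinger (B.localRep s i e) z * wirtingerBar (B.localRep s i e) z = 0

/-- `x` is a critical point of `s`: the differential at `x` of the local expression of `s` in a
(flat) fibre coordinate is not surjective. -/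
def IsCriticalPoint (B : DiscBundle ι C) (s : C → B.P) (x : C) : Prop :=
  ¬ Function.Surjective
    (fderiv ℝ (B.localRep s (B.indexAt x) (chartAt ℂ x)) (chartAt ℂ x x))

end DiscBundle

/-! On each fibre let `ρ` be the squared pseudo-hyperbolic distance to the section. The gap `1 - ρ =
(1 - |h|²)(1 - |ζ|²) / |1 - h̄ζ|²` does not change under disc automorphisms, so it is globally
defined near the closure of `D`. The defining function is `r = -exp(-f) (1 - ρ)` with a small weight
`f = εψ` on `C`, so that `-log(-r) = εψ - log(1 - ρ)`.

Write `a = h_z` and `b = h_z̄`. Harmonicity expresses `h_{z z̄}` through `a` and `b`, so the Levi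
form of `-log(1 - ρ)` involves only first derivatives of `h` (`hasWirtinger_neg_log_discGap`).
Absorbing the mixed term by completing a square bounds this form below by `κ |v₁|² + |v₂|² / 2`,
where `κ = |a|² + |b|² - 2|a||b|ρ - 2(1 - ρ)²|a|²`, as soon as `κ ≥ 0` (`re_leviExpr_ge`). On the
boundary `ρ = 1` and `κ = (|a| - |b|)²`. This is positive where the differential of `h` is
surjective, because its Jacobian is `|a|² - |b|²`, and the positivity survives a small perturbation
by `εψ`.

At a critical point `κ` may vanish on the boundary, but `κ ≥ 0` for all `ρ ≥ 1/3`
(`leviCoeff_nonneg`). There `ψ` is chosen to be `|z - z₀|²`, which supplies the missing `ε |v₁|²`;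
finiteness of the critical set makes such a `ψ` available. These two cases are
`exists_flatLevi_bound`. Compactness of the boundary then gives one `ε` and one multiple of a
Hermitian metric that work near all of it. Takeuchi 1-convexity follows by diagonalizing the Levi
form with respect to that metric. -/

/-! ### Wirtinger calculus up to the mixed second derivative -/

theorem wirtinger_congr {X Y : ℂ → ℂ} {t : ℂ} (h : X =ᶠ[𝓝 t] Y) :
    wirtinger X t = wirtinger Y t := by
  simp only [wirtinger, h.fderiv_eq]

theorem wirtingerBar_congr {X Y : ℂ → ℂ} {t : ℂ} (h : X =ᶠ[𝓝 t] Y) :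
    wirtingerBar X t = wirtingerBar Y t := by
  simp only [wirtingerBar, h.fderiv_eq]

theorem wirtingerBar_eventuallyEq {X Y : ℂ → ℂ} {t : ℂ} (h : X =ᶠ[𝓝 t] Y) :
    wirtingerBar X =ᶠ[𝓝 t] wirtingerBar Y := by
  filter_upwards [h.eventuallyEq_nhds] with u hu using wirtingerBar_congr hu

theorem wirtinger_add {X Y : ℂ → ℂ} {t : ℂ} (hX : DifferentiableAt ℝ X t)
    (hY : DifferentiableAt ℝ Y t) :
    wirtinger (fun u ↦ X u + Y u) t = wirtinger X t + wirtinger Y t := by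
  simp only [wirtinger, fderiv_fun_add hX hY, add_apply]
  ring

theorem wirtingerBar_add {X Y : ℂ → ℂ} {t : ℂ} (hX : DifferentiableAt ℝ X t)
    (hY : DifferentiableAt ℝ Y t) :
    wirtingerBar (fun u ↦ X u + Y u) t = wirtingerBar X t + wirtingerBar Y t := by
  simp only [wirtingerBar, fderiv_fun_add hX hY, add_apply]
  ring

theorem wirtinger_mul {X Y : ℂ → ℂ} {t : ℂ} (hX : DifferentiableAt ℝ X t)
    (hY : DifferentiableAt ℝ Y t) :
    wirtinger (fun u ↦ X u * Y u) t = X t * wirtinger Y t + wirtinger X t * Y t := by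
  simp only [wirtinger, fderiv_fun_mul hX hY, add_apply,
    smul_apply, smul_eq_mul]
  ring

theorem wirtingerBar_mul {X Y : ℂ → ℂ} {t : ℂ} (hX : DifferentiableAt ℝ X t)
    (hY : DifferentiableAt ℝ Y t) :
    wirtingerBar (fun u ↦ X u * Y u) t = X t * wirtingerBar Y t + wirtingerBar X t * Y t := by
  simp only [wirtingerBar, fderiv_fun_mul hX hY, add_apply,
    smul_apply, smul_eq_mul]
  ring

theorem fderiv_conj_comp {X : ℂ → ℂ} {t : ℂ} (hX : DifferentiableAt ℝ X t) (v : ℂ) :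
    fderiv ℝ (fun u ↦ conj (X u)) t v = conj (fderiv ℝ X t v) := by
  have := (Complex.conjCLE.toContinuousLinearMap.hasFDerivAt (x := X t)).comp t hX.hasFDerivAt
  have h2 : HasFDerivAt (fun u ↦ conj (X u)) _ t := this
  rw [h2.fderiv]; rfl

theorem wirtinger_conj {X : ℂ → ℂ} {t : ℂ} (hX : DifferentiableAt ℝ X t) :
    wirtinger (fun u ↦ conj (X u)) t = conj (wirtingerBar X t) := by
  simp [wirtinger, wirtingerBar, fderiv_conj_comp hX, Complex.conj_ofNat]
  ring

theorem wirtingerBar_conj {X : ℂ → ℂ} {t : ℂ} (hX : DifferentiableAt ℝ X t) :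
    wirtingerBar (fun u ↦ conj (X u)) t = conj (wirtinger X t) := by
  simp [wirtinger, wirtingerBar, fderiv_conj_comp hX, Complex.conj_ofNat]

theorem ContDiffAt.eventually_differentiableAt_two {E F : Type*} [NormedAddCommGroup E]
    [NormedSpace ℝ E] [NormedAddCommGroup F] [NormedSpace ℝ F] {X : E → F} {t : E}
    (hX : ContDiffAt ℝ 2 X t) : ∀ᶠ u in 𝓝 t, DifferentiableAt ℝ X u := by
  filter_upwards [hX.eventually (by simp)] with u hu using hu.differentiableAt (by simp)

theorem ContDiffAt.differentiableAt_fderiv {E F : Type*} [NormedAddCommGroup E]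
    [NormedSpace ℝ E] [NormedAddCommGroup F] [NormedSpace ℝ F] {X : E → F} {t : E}
    (hX : ContDiffAt ℝ 2 X t) : DifferentiableAt ℝ (fderiv ℝ X) t :=
  (hX.fderiv_right (m := 1) (by norm_num)).differentiableAt (by simp)

theorem differentiableAt_wirtinger {X : ℂ → ℂ} {t : ℂ} (hX : ContDiffAt ℝ 2 X t) :
    DifferentiableAt ℝ (wirtinger X) t := by
  have := hX.differentiableAt_fderiv
  unfold wirtinger
  fun_prop

theorem differentiableAt_wirtingerBar {X : ℂ → ℂ} {t : ℂ} (hX : ContDiffAt ℝ 2 X t) :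
    DifferentiableAt ℝ (wirtingerBar X) t := by
  have := hX.differentiableAt_fderiv
  unfold wirtingerBar
  fun_prop

theorem fderiv_wirtinger {X : ℂ → ℂ} {t : ℂ} (hX : ContDiffAt ℝ 2 X t) (v : ℂ) :
    fderiv ℝ (wirtinger X) t v =
      (fderiv ℝ (fderiv ℝ X) t v 1 - Complex.I * fderiv ℝ (fderiv ℝ X) t v Complex.I) / 2 := by
  have h := hX.differentiableAt_fderiv.hasFDerivAt
  have h1 := h.clm_apply (hasFDerivAt_const (1 : ℂ) t)
  have h2 := (h.clm_apply (hasFDerivAt_const Complex.I t)).const_mul Complex.I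
  have h3 := ((h1.sub h2).const_mul (2⁻¹ : ℂ))
  have h4 : wirtinger X = fun y ↦ 2⁻¹ * (((fun y ↦ (fderiv ℝ X y) 1) -
      fun y ↦ Complex.I * (fderiv ℝ X y) Complex.I) y) := by
    funext y; simp [wirtinger]; ring
  rw [h4, h3.fderiv]
  simp
  ring

theorem fderiv_wirtingerBar {X : ℂ → ℂ} {t : ℂ} (hX : ContDiffAt ℝ 2 X t) (v : ℂ) :
    fderiv ℝ (wirtingerBar X) t v =
      (fderiv ℝ (fderiv ℝ X) t v 1 + Complex.I * fderiv ℝ (fderiv ℝ X) t v Complex.I) / 2 := by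
  have h := hX.differentiableAt_fderiv.hasFDerivAt
  have h1 := h.clm_apply (hasFDerivAt_const (1 : ℂ) t)
  have h2 := (h.clm_apply (hasFDerivAt_const Complex.I t)).const_mul Complex.I
  have h3 := ((h1.add h2).const_mul (2⁻¹ : ℂ))
  have h4 : wirtingerBar X = fun y ↦ 2⁻¹ * (((fun y ↦ (fderiv ℝ X y) 1) +
      fun y ↦ Complex.I * (fderiv ℝ X y) Complex.I) y) := by
    funext y; simp [wirtingerBar]; ring
  rw [h4, h3.fderiv]
  simp
  ring

theorem ContDiffAt.fderiv_fderiv_symm {E F : Type*} [NormedAddCommGroup E]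
    [NormedSpace ℝ E] [NormedAddCommGroup F] [NormedSpace ℝ F] {X : E → F} {t : E}
    (hX : ContDiffAt ℝ 2 X t) (v w : E) :
    fderiv ℝ (fderiv ℝ X) t v w = fderiv ℝ (fderiv ℝ X) t w v :=
  (hX.isSymmSndFDerivAt (by simp)).eq v w

/-- Symmetry of the second derivative. It is needed because conjugation exchanges the two Wirtinger
operators and so reverses their order. -/
theorem wirtingerBar_wirtinger {X : ℂ → ℂ} {t : ℂ} (hX : ContDiffAt ℝ 2 X t) :
    wirtingerBar (wirtinger X) t = wirtinger (wirtingerBar X) t := by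
  rw [wirtinger, wirtingerBar]
  simp only [fderiv_wirtinger hX, fderiv_wirtingerBar hX]
  rw [hX.fderiv_fderiv_symm Complex.I 1]
  ring

/-- The function `X` is `C²` at `t`, with value `x`, Wirtinger derivatives `x1` and `x2`, and mixed
second Wirtinger derivative `x12`. -/
structure HasWirtinger (X : ℂ → ℂ) (t x x1 x2 x12 : ℂ) : Prop where
  contDiffAt : ContDiffAt ℝ 2 X t
  value : X t = x
  wirtinger : wirtinger X t = x1
  wirtingerBar : wirtingerBar X t = x2
  mixed : _root_.wirtinger (_root_.wirtingerBar X) t = x12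

namespace HasWirtinger

variable {X Y : ℂ → ℂ} {t x x1 x2 x12 y y1 y2 y12 : ℂ}

theorem diff (hX : HasWirtinger X t x x1 x2 x12) : DifferentiableAt ℝ X t :=
  hX.contDiffAt.differentiableAt (by simp)

theorem congr (hX : HasWirtinger X t x x1 x2 x12) (h : Y =ᶠ[𝓝 t] X) :
    HasWirtinger Y t x x1 x2 x12 where
  contDiffAt := hX.contDiffAt.congr_of_eventuallyEq h
  value := h.eq_of_nhds.trans hX.value
  wirtinger := (wirtinger_congr h).trans hX.wirtinger
  wirtingerBar := (wirtingerBar_congr h).trans hX.wirtingerBar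
  mixed := (wirtinger_congr (wirtingerBar_eventuallyEq h)).trans hX.mixed

theorem add (hX : HasWirtinger X t x x1 x2 x12) (hY : HasWirtinger Y t y y1 y2 y12) :
    HasWirtinger (fun u ↦ X u + Y u) t (x + y) (x1 + y1) (x2 + y2) (x12 + y12) where
  contDiffAt := hX.contDiffAt.add hY.contDiffAt
  value := by rw [hX.value, hY.value]
  wirtinger := by rw [wirtinger_add hX.diff hY.diff, hX.wirtinger, hY.wirtinger]
  wirtingerBar := by rw [wirtingerBar_add hX.diff hY.diff, hX.wirtingerBar, hY.wirtingerBar]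
  mixed := by
    have h : _root_.wirtingerBar (fun u ↦ X u + Y u) =ᶠ[𝓝 t]
        fun u ↦ _root_.wirtingerBar X u + _root_.wirtingerBar Y u := by
      filter_upwards [hX.contDiffAt.eventually_differentiableAt_two,
        hY.contDiffAt.eventually_differentiableAt_two] with u h1 h2
      exact wirtingerBar_add h1 h2
    rw [wirtinger_congr h, wirtinger_add (differentiableAt_wirtingerBar hX.contDiffAt)
      (differentiableAt_wirtingerBar hY.contDiffAt), hX.mixed, hY.mixed]

theorem mul (hX : HasWirtinger X t x x1 x2 x12) (hY : HasWirtinger Y t y y1 y2 y12) :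
    HasWirtinger (fun u ↦ X u * Y u) t (x * y) (x * y1 + x1 * y) (x * y2 + x2 * y)
      (x * y12 + x1 * y2 + (x2 * y1 + x12 * y)) where
  contDiffAt := hX.contDiffAt.mul hY.contDiffAt
  value := by rw [hX.value, hY.value]
  wirtinger := by
    rw [wirtinger_mul hX.diff hY.diff, hX.wirtinger, hY.wirtinger, hX.value, hY.value]
  wirtingerBar := by
    rw [wirtingerBar_mul hX.diff hY.diff, hX.wirtingerBar, hY.wirtingerBar, hX.value, hY.value]
  mixed := by
    have h : _root_.wirtingerBar (fun u ↦ X u * Y u) =ᶠ[𝓝 t]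
        fun u ↦ X u * _root_.wirtingerBar Y u + _root_.wirtingerBar X u * Y u := by
      filter_upwards [hX.contDiffAt.eventually_differentiableAt_two,
        hY.contDiffAt.eventually_differentiableAt_two] with u h1 h2
      exact wirtingerBar_mul h1 h2
    have hX' := differentiableAt_wirtingerBar hX.contDiffAt
    have hY' := differentiableAt_wirtingerBar hY.contDiffAt
    rw [wirtinger_congr h, wirtinger_add (hX.diff.fun_mul hY') (hX'.fun_mul hY.diff),
      wirtinger_mul hX.diff hY', wirtinger_mul hX' hY.diff, hX.mixed, hY.mixed, hX.value,
      hY.value, hX.wirtinger, hY.wirtinger, hX.wirtingerBar, hY.wirtingerBar]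

theorem const (c t : ℂ) : HasWirtinger (fun _ ↦ c) t c 0 0 0 where
  contDiffAt := contDiffAt_const
  value := rfl
  wirtinger := by simp [_root_.wirtinger]
  wirtingerBar := by simp [_root_.wirtingerBar]
  mixed := by
    have : _root_.wirtingerBar (fun _ : ℂ ↦ c) = fun _ ↦ 0 := by
      funext u; simp [_root_.wirtingerBar]
    rw [this]; simp [_root_.wirtinger]

theorem neg (hX : HasWirtinger X t x x1 x2 x12) :
    HasWirtinger (fun u ↦ -X u) t (-x) (-x1) (-x2) (-x12) := by
  convert! (const (-1) t).mul hX using 1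
  · simp
  all_goals ring

theorem sub (hX : HasWirtinger X t x x1 x2 x12) (hY : HasWirtinger Y t y y1 y2 y12) :
    HasWirtinger (fun u ↦ X u - Y u) t (x - y) (x1 - y1) (x2 - y2) (x12 - y12) := by
  simpa only [sub_eq_add_neg] using hX.add hY.neg

theorem conj_comp (hX : HasWirtinger X t x x1 x2 x12) :
    HasWirtinger (fun u ↦ conj (X u)) t (conj x) (conj x2) (conj x1) (conj x12) where
  contDiffAt := Complex.conjCLE.contDiff.contDiffAt.comp t hX.contDiffAt
  value := by rw [hX.value]
  wirtinger := by rw [wirtinger_conj hX.diff, hX.wirtingerBar]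
  wirtingerBar := by rw [wirtingerBar_conj hX.diff, hX.wirtinger]
  mixed := by
    have h : _root_.wirtingerBar (fun u ↦ (starRingEnd ℂ) (X u)) =ᶠ[𝓝 t]
        fun u ↦ (starRingEnd ℂ) (_root_.wirtinger X u) := by
      filter_upwards [hX.contDiffAt.eventually_differentiableAt_two] with u h1
      exact wirtingerBar_conj h1
    rw [wirtinger_congr h, wirtinger_conj (differentiableAt_wirtinger hX.contDiffAt),
      wirtingerBar_wirtinger hX.contDiffAt, hX.mixed]

theorem log (hX : HasWirtinger X t x x1 x2 x12) (hx : x ∈ Complex.slitPlane) :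
    HasWirtinger (fun u ↦ Complex.log (X u)) t (Complex.log x) (x1 / x) (x2 / x)
      ((x12 - x1 * x2 / x) / x) := by
  have hx0 : x ≠ 0 := Complex.slitPlane_ne_zero hx
  have hx' : X t ∈ Complex.slitPlane := by rwa [hX.value]
  have hc : ContDiffAt ℝ 2 (fun u ↦ Complex.log (X u)) t :=
    ((Complex.contDiffAt_log hx' (n := 2)).restrict_scalars ℝ).comp t hX.contDiffAt
  -- The identity `X = exp (log X)` is differentiated, rather than the logarithm: first derivatives
  -- of `log X` come from dividing by `X`, and differentiating `X_z̄ = X (log X)_z̄` once more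
  -- yields the mixed one.
  have hev : X =ᶠ[𝓝 t] fun u ↦ Complex.exp (Complex.log (X u)) := by
    filter_upwards [hX.contDiffAt.continuousAt.eventually
      (Complex.isOpen_slitPlane.mem_nhds hx')] with u hu
    rw [Complex.exp_log (Complex.slitPlane_ne_zero hu)]
  have hd : ∀ᶠ u in 𝓝 t, ∀ v, fderiv ℝ X u v = X u * fderiv ℝ (fun u ↦ Complex.log (X u)) u v := by
    filter_upwards [hev.eventuallyEq_nhds, hc.eventually_differentiableAt_two,
      hX.contDiffAt.continuousAt.eventually (Complex.isOpen_slitPlane.mem_nhds hx')]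
      with u hu hdu hs v
    rw [hu.fderiv_eq, hdu.hasFDerivAt.cexp.fderiv]
    simp [Complex.exp_log (Complex.slitPlane_ne_zero hs)]
  have h2 : ∀ᶠ u in 𝓝 t, _root_.wirtingerBar X u =
      X u * _root_.wirtingerBar (fun u ↦ Complex.log (X u)) u := by
    filter_upwards [hd] with u hu
    simp only [_root_.wirtingerBar, hu]
    ring
  have h1 : _root_.wirtinger X t = X t * _root_.wirtinger (fun u ↦ Complex.log (X u)) t := by
    simp only [_root_.wirtinger, hd.self_of_nhds]
    ring
  have e2 := h2.self_of_nhds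
  rw [hX.wirtingerBar, hX.value] at e2
  rw [hX.wirtinger, hX.value] at h1
  have e12 := wirtinger_congr h2
  rw [wirtinger_mul hX.diff (differentiableAt_wirtingerBar hc), hX.mixed, hX.value,
    hX.wirtinger] at e12
  have f2 : _root_.wirtingerBar (fun u ↦ Complex.log (X u)) t = x2 / x := by
    rw [eq_div_iff hx0]; linear_combination -e2
  refine ⟨hc, by rw [hX.value], ?_, f2, ?_⟩
  · rw [eq_div_iff hx0]; linear_combination -h1
  · rw [f2] at e12
    rw [eq_div_iff hx0]; linear_combination -e12

/-- The map `t ↦ z + t v` is holomorphic, so the `z`-derivative picks up `v` and the `z̄`-derivative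
its conjugate. Through this rule Levi forms in two variables become one-variable computations. -/
theorem comp_line {h : ℂ → ℂ} {z : ℂ} (hh : HasWirtinger h z x x1 x2 x12) (v : ℂ) :
    HasWirtinger (fun t ↦ h (z + t * v)) 0 x (v * x1) ((starRingEnd ℂ) v * x2)
      (v * (starRingEnd ℂ) v * x12) := by
  have key : ∀ {k : ℂ → ℂ} {t : ℂ}, DifferentiableAt ℝ k (z + t * v) →
      ∀ u, fderiv ℝ (fun t ↦ k (z + t * v)) t u = fderiv ℝ k (z + t * v) (u * v) := by
    intro k t hk u
    have hl : HasFDerivAt (𝕜 := ℝ) (fun t : ℂ ↦ z + t * v) _ t :=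
      ((hasFDerivAt_id t).mul_const v).const_add z
    have := hk.hasFDerivAt.comp t hl
    have h2 : HasFDerivAt (fun t ↦ k (z + t * v)) _ t := this
    rw [h2.fderiv]
    simp [mul_comm]
  have dec : ∀ (L : ℂ →L[ℝ] ℂ) (u : ℂ), L u = u.re * L 1 + u.im * L Complex.I := by
    intro L u
    conv_lhs => rw [← Complex.re_add_im u]
    rw [map_add, ← mul_one (u.re : ℂ), ← Complex.real_smul, ← Complex.real_smul, map_smul,
      map_smul]
    simp
  have hc : (starRingEnd ℂ) v = v.re - v.im * Complex.I := by
    apply Complex.ext <;> simp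
  have kw : ∀ {k : ℂ → ℂ} {t : ℂ}, DifferentiableAt ℝ k (z + t * v) →
      _root_.wirtinger (fun t ↦ k (z + t * v)) t = v * _root_.wirtinger k (z + t * v) := by
    intro k t hk
    simp only [_root_.wirtinger, key hk]
    rw [dec _ (1 * v), dec _ (Complex.I * v)]
    simp
    linear_combination (v.im : ℂ) * (fderiv ℝ k (z + t * v)) Complex.I / 2 * Complex.I_sq +
      ((fderiv ℝ k (z + t * v)) 1 - Complex.I * (fderiv ℝ k (z + t * v)) Complex.I) / 2 *
        Complex.re_add_im v
  have kwb : ∀ {k : ℂ → ℂ} {t : ℂ}, DifferentiableAt ℝ k (z + t * v) →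
      _root_.wirtingerBar (fun t ↦ k (z + t * v)) t =
        (starRingEnd ℂ) v * _root_.wirtingerBar k (z + t * v) := by
    intro k t hk
    simp only [_root_.wirtingerBar, key hk]
    rw [dec _ (1 * v), dec _ (Complex.I * v)]
    simp
    linear_combination (v.im : ℂ) * (fderiv ℝ k (z + t * v)) Complex.I / 2 * Complex.I_sq -
      ((fderiv ℝ k (z + t * v)) 1 + Complex.I * (fderiv ℝ k (z + t * v)) Complex.I) / 2 *
        hc
  have hl : ContDiff ℝ 2 (fun t : ℂ ↦ z + t * v) := by fun_prop
  have h0 : z + 0 * v = z := by ring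
  have hh0 : ContDiffAt ℝ 2 h (z + 0 * v) := by rw [h0]; exact hh.contDiffAt
  refine ⟨hh0.comp 0 hl.contDiffAt, by simp [hh.value], ?_, ?_, ?_⟩
  · rw [kw (hh0.differentiableAt (by simp)), h0, hh.wirtinger]
  · rw [kwb (hh0.differentiableAt (by simp)), h0, hh.wirtingerBar]
  · have hev : _root_.wirtingerBar (fun t ↦ h (z + t * v)) =ᶠ[𝓝 0]
        fun t ↦ (starRingEnd ℂ) v * _root_.wirtingerBar h (z + t * v) := by
      filter_upwards [hl.continuous.continuousAt.eventually hh0.eventually_differentiableAt_two]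
        with t ht using kwb ht
    have hd : DifferentiableAt ℝ (_root_.wirtingerBar h) (z + 0 * v) :=
      differentiableAt_wirtingerBar hh0
    have hd' : DifferentiableAt ℝ (fun t ↦ _root_.wirtingerBar h (z + t * v)) 0 :=
      DifferentiableAt.comp (g := _root_.wirtingerBar h) 0 hd (hl.differentiable (by simp) _)
    rw [wirtinger_congr hev, wirtinger_mul (differentiableAt_const _) hd', kw hd, h0, hh.mixed,
      ((const ((starRingEnd ℂ) v) 0).wirtinger)]
    ring

end HasWirtinger

/-! ### The Levi form on a complex normed space -/

section FlatLevi

variable {E : Type*} [NormedAddCommGroup E] [NormedSpace ℂ E]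

/-- The (real part of the) Levi form of a function on a complex normed space. -/
noncomputable def flatLevi (F : E → ℝ) (x v w : E) : ℝ :=
  (fderiv ℝ (fderiv ℝ F) x v w + fderiv ℝ (fderiv ℝ F) x (Complex.I • v) (Complex.I • w)) / 4

theorem leviForm_eq_flatLevi {X : Type*} [TopologicalSpace X] [ChartedSpace E X] (u : X → ℝ)
    (p : X) (v w : E) :
    leviForm u p v w = flatLevi (u ∘ (chartAt E p).symm) (chartAt E p p) v w := rfl

theorem flatLevi_congr {F G : E → ℝ} {x : E} (h : F =ᶠ[𝓝 x] G) (v w : E) :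
    flatLevi F x v w = flatLevi G x v w := by
  have : fderiv ℝ F =ᶠ[𝓝 x] fderiv ℝ G := h.fderiv
  simp only [flatLevi, this.fderiv_eq]

theorem flatLevi_I {F : E → ℝ} {x : E} (v w : E) :
    flatLevi F x (Complex.I • v) (Complex.I • w) = flatLevi F x v w := by
  simp only [flatLevi, smul_smul, Complex.I_mul_I, neg_smul, one_smul, map_neg, neg_neg,
    neg_apply]
  ring

theorem flatLevi_symm {F : E → ℝ} {x : E} (hF : ContDiffAt ℝ 2 F x) (v w : E) :
    flatLevi F x v w = flatLevi F x w v := by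
  simp only [flatLevi, hF.fderiv_fderiv_symm v w,
    hF.fderiv_fderiv_symm (Complex.I • v) (Complex.I • w)]

theorem flatLevi_add_right (F : E → ℝ) (x v w w' : E) :
    flatLevi F x v (w + w') = flatLevi F x v w + flatLevi F x v w' := by
  simp only [flatLevi, smul_add, map_add]; ring

theorem flatLevi_smul_right (F : E → ℝ) (x v w : E) (c : ℝ) :
    flatLevi F x v (c • w) = c * flatLevi F x v w := by
  simp only [flatLevi, smul_comm _ c, map_smul, smul_eq_mul]; ring

/-- The Levi form on the diagonal is the mixed Wirtinger derivative on a complex line. -/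
theorem flatLevi_eq_of_hasWirtinger {F : E → ℝ} {x v : E} (hF : ContDiffAt ℝ 2 F x)
    {a b c d : ℂ} (h : HasWirtinger (fun t : ℂ ↦ (F (x + t • v) : ℂ)) 0 a b c d) :
    flatLevi F x v v = d.re := by
  set L : ℂ →L[ℝ] E := (ContinuousLinearMap.id ℝ ℂ).smulRight v with hL
  have hLu : ∀ u : ℂ, L u = u • v := fun u ↦ rfl
  have hl : ∀ t : ℂ, HasFDerivAt (𝕜 := ℝ) (fun t : ℂ ↦ x + t • v) L t := fun t ↦
    (L.hasFDerivAt (x := t)).const_add x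
  have hF0 : ContDiffAt ℝ 2 F (x + (0 : ℂ) • v) := by simpa using hF
  have hc : ContinuousAt (fun t : ℂ ↦ x + t • v) 0 := by fun_prop
  have e1 : wirtingerBar (fun t : ℂ ↦ (F (x + t • v) : ℂ)) =ᶠ[𝓝 0] fun t ↦
      ((fderiv ℝ F (x + t • v) v : ℝ) + Complex.I *
        (fderiv ℝ F (x + t • v) (Complex.I • v) : ℝ)) / 2 := by
    filter_upwards [hc.eventually hF0.eventually_differentiableAt_two] with t ht
    have h1 := Complex.ofRealCLM.hasFDerivAt.comp t (ht.hasFDerivAt.comp t (hl t))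
    have h2 : HasFDerivAt (fun t : ℂ ↦ (F (x + t • v) : ℂ)) _ t := h1
    simp [wirtingerBar, h2.fderiv, hLu]
  have hD := hF0.differentiableAt_fderiv.hasFDerivAt.comp (0 : ℂ) (hl 0)
  have hD1 := Complex.ofRealCLM.hasFDerivAt.comp (0 : ℂ) (hD.clm_apply (hasFDerivAt_const v _))
  have hD2 := Complex.ofRealCLM.hasFDerivAt.comp (0 : ℂ)
    (hD.clm_apply (hasFDerivAt_const (Complex.I • v) _))
  have h3 := (hD1.add (hD2.const_mul Complex.I)).const_mul (2⁻¹ : ℂ)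
  have h4 := h3.congr_of_eventuallyEq (f₁ := wirtingerBar (fun t : ℂ ↦ (F (x + t • v) : ℂ))) (by
    filter_upwards [e1] with t ht
    rw [ht]
    simp
    ring)
  have h5 := h.mixed
  rw [wirtinger, h4.fderiv] at h5
  rw [← h5, flatLevi]
  have hs := hF.fderiv_fderiv_symm v (Complex.I • v)
  simp [hLu, hs]
  ring

end FlatLevi

/-- The Levi form is invariant under holomorphic maps. -/
theorem flatLevi_comp {E E' : Type*} [NormedAddCommGroup E] [NormedSpace ℂ E]
    [NormedAddCommGroup E'] [NormedSpace ℂ E'] {F : E' → ℝ} {τ : E → E'} {x : E}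
    (hτ : ContDiffAt ℂ ω τ x) (hF : ContDiffAt ℝ 2 F (τ x)) (v w : E) :
    flatLevi (F ∘ τ) x v w = flatLevi F (τ x) (fderiv ℂ τ x v) (fderiv ℂ τ x w) := by
  have hτ2 : ContDiffAt ℂ 2 τ x := hτ.of_le le_top
  have hd : ∀ᶠ y in 𝓝 x, DifferentiableAt ℂ τ y := by
    filter_upwards [hτ2.eventually (by simp)] with y hy using hy.differentiableAt (by simp)
  have e1 : fderiv ℝ (F ∘ τ) =ᶠ[𝓝 x] fun y ↦
      (fderiv ℝ F (τ y)).comp ((fderiv ℂ τ y).restrictScalars ℝ) := by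
    filter_upwards [hd, hτ.continuousAt.eventually hF.eventually_differentiableAt_two]
      with y hy hFy
    exact (hFy.hasFDerivAt.comp y (hy.hasFDerivAt.restrictScalars ℝ)).fderiv
  have h1 := hF.differentiableAt_fderiv.hasFDerivAt.comp x
    (hd.self_of_nhds.hasFDerivAt.restrictScalars ℝ)
  have h2 : HasFDerivAt (fderiv ℂ τ) _ x :=
    ((hτ2.fderiv_right (m := 1) (by norm_num)).differentiableAt (by simp)).hasFDerivAt
  have h3 := (ContinuousLinearMap.restrictScalarsL ℂ E E' ℝ ℝ).hasFDerivAt.comp x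
    (h2.restrictScalars ℝ)
  have h4 := h1.clm_comp h3
  have h5 : HasFDerivAt (fun y ↦
      (fderiv ℝ F (τ y)).comp ((fderiv ℂ τ y).restrictScalars ℝ)) _ x := h4
  -- The second derivative of `τ` is complex bilinear, so its values at `(v, w)` and `(iv, iw)`
  -- cancel. Only the second derivative of `F`, applied to the images under `Dτ`, remains.
  have hI : ∀ y : E', Complex.I • Complex.I • y = -y := fun y ↦ by
    rw [smul_smul, Complex.I_mul_I, neg_smul, one_smul]
  simp only [flatLevi, e1.fderiv_eq, h5.fderiv]
  simp [hI]
  ring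

/-! ### Hermitian forms given by their real parts, and their diagonalization -/

/-- A symmetric real bilinear form on a complex vector space that is invariant under
multiplication by `i`, that is, the real part of a Hermitian form. -/
structure IsHermitianRe {V : Type*} [AddCommGroup V] [Module ℂ V] (L : V → V → ℝ) : Prop where
  symm : ∀ v w, L v w = L w v
  add_right : ∀ v w w', L v (w + w') = L v w + L v w'
  smul_right : ∀ v w (c : ℝ), L v ((c : ℂ) • w) = c * L v w
  inv_I : ∀ v w, L (Complex.I • v) (Complex.I • w) = L v w

namespace IsHermitianRe

variable {V : Type*} [AddCommGroup V] [Module ℂ V] {L : V → V → ℝ} (hL : IsHermitianRe L)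

/-- The Hermitian form with given real part, conjugate-linear in the first variable. -/
noncomputable def herm (L : V → V → ℝ) (v w : V) : ℂ := L v w + Complex.I * L (Complex.I • v) w

include hL

/-- Invariance under `i` together with `i² = -1` makes multiplication by `i` skew for `L`. This is
what makes `herm` complex linear in its second variable. -/
theorem I_right (v w : V) : L v (Complex.I • w) = -L (Complex.I • v) w := by
  have h := hL.inv_I (Complex.I • v) w
  rw [smul_smul, Complex.I_mul_I, neg_smul, one_smul] at h
  have h2 := hL.smul_right (Complex.I • w) v (-1)
  simp only [Complex.ofReal_neg, Complex.ofReal_one, neg_smul, one_smul, neg_mul, one_mul] at h2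
  rw [hL.symm, h2] at h
  rw [hL.symm v]
  linarith

theorem herm_add_right (v w w' : V) : herm L v (w + w') = herm L v w + herm L v w' := by
  simp only [herm, hL.add_right]; push_cast; ring

theorem herm_smul_right (c : ℂ) (v w : V) : herm L v (c • w) = c * herm L v w := by
  have hI : herm L v (Complex.I • w) = Complex.I * herm L v w := by
    simp only [herm, hL.I_right, smul_smul, Complex.I_mul_I, neg_smul, one_smul]
    have h2 := hL.smul_right w v (-1)
    simp only [Complex.ofReal_neg, Complex.ofReal_one, neg_smul, one_smul, neg_mul, one_mul] at h2
    rw [hL.symm (-v), h2, hL.symm w]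
    push_cast
    linear_combination -(L (Complex.I • v) w : ℂ) * Complex.I_sq
  have hR : ∀ (r : ℝ) u, herm L v ((r : ℂ) • u) = r * herm L v u := by
    intro r u
    simp only [herm, hL.smul_right]; push_cast; ring
  conv_lhs => rw [← Complex.re_add_im c, add_smul, mul_smul, hL.herm_add_right, hR, hR, hI]
  conv_rhs => rw [← Complex.re_add_im c]
  ring

theorem conj_herm (v w : V) : conj (herm L v w) = herm L w v := by
  simp only [herm, map_add, map_mul, Complex.conj_I, Complex.conj_ofReal, hL.symm v w,
    hL.symm (Complex.I • v) w, hL.I_right]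
  push_cast
  ring

end IsHermitianRe

/-- A Hermitian form on a finite-dimensional Hermitian space is diagonalizable. -/
theorem exists_basis_of_hermitianRe {V : Type*} [AddCommGroup V] [Module ℂ V]
    [FiniteDimensional ℂ V] {g L : V → V → ℝ} (hg : IsHermitianRe g)
    (hpos : ∀ v, v ≠ 0 → 0 < g v v) (hL : IsHermitianRe L) :
    ∃ (v : Fin (Module.finrank ℂ V) → V) (c : Fin (Module.finrank ℂ V) → ℝ),
      LinearIndependent ℂ v ∧ ∀ j w, L (v j) w = c j * g (v j) w := by
  have hre : ∀ {b : V → V → ℝ} (v w : V), (IsHermitianRe.herm b v w).re = b v w := by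
    intro b v w; simp [IsHermitianRe.herm]
  -- The form `g` becomes an inner product. Riesz representation then turns `L` into a self-adjoint
  -- operator, whose orthonormal eigenbasis is the required family.
  let core : InnerProductSpace.Core ℂ V :=
    { inner := IsHermitianRe.herm g
      conj_inner_symm := fun v w ↦ hg.conj_herm w v
      re_inner_nonneg := fun v ↦ by
        show 0 ≤ (IsHermitianRe.herm g v v).re
        rw [hre]
        rcases eq_or_ne v 0 with rfl | hv
        · have := hg.smul_right 0 0 0
          simp at this
          exact this.ge
        · exact (hpos v hv).le
      add_left := fun u v w ↦ by
        rw [← hg.conj_herm, hg.herm_add_right, map_add, hg.conj_herm, hg.conj_herm]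
      smul_left := fun u v c ↦ by
        rw [← hg.conj_herm, hg.herm_smul_right, map_mul, hg.conj_herm]
      definite := fun v hv ↦ by
        by_contra h
        have := hpos v h
        rw [← hre (b := g), hv] at this
        simp at this }
  let _ : NormedAddCommGroup V := core.toNormedAddCommGroup
  let _ : InnerProductSpace ℂ V := InnerProductSpace.ofCore core.toCore
  have hin : ∀ v w : V, inner ℂ v w = IsHermitianRe.herm g v w := fun v w ↦ rfl
  let ℓ : V → (V →ₗ[ℂ] ℂ) := fun v ↦
    { toFun := IsHermitianRe.herm L v
      map_add' := hL.herm_add_right v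
      map_smul' := fun c w ↦ hL.herm_smul_right c v w }
  have : CompleteSpace V := FiniteDimensional.complete ℂ V
  let S : V → V := fun v ↦ (InnerProductSpace.toDual ℂ V).symm (LinearMap.toContinuousLinearMap (ℓ v))
  have hS : ∀ v w, inner ℂ (S v) w = IsHermitianRe.herm L v w := fun v w ↦ by
    simp only [S, InnerProductSpace.toDual_symm_apply]
    rfl
  let T : V →ₗ[ℂ] V :=
    { toFun := S
      map_add' := fun u v ↦ ext_inner_right ℂ fun w ↦ by
        rw [inner_add_left, hS, hS, hS, ← hL.conj_herm, hL.herm_add_right, map_add, hL.conj_herm,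
          hL.conj_herm]
      map_smul' := fun c v ↦ ext_inner_right ℂ fun w ↦ by
        rw [RingHom.id_apply, inner_smul_left, hS, hS, ← hL.conj_herm, hL.herm_smul_right,
          map_mul, hL.conj_herm] }
  have hT : T.IsSymmetric := fun v w ↦ by
    rw [← inner_conj_symm v]
    show inner ℂ (S v) w = conj (inner ℂ (S w) v)
    rw [hS, hS, hL.conj_herm]
  refine ⟨hT.eigenvectorBasis rfl, hT.eigenvalues rfl,
    (hT.eigenvectorBasis rfl).orthonormal.linearIndependent, fun j w ↦ ?_⟩
  have h1 := hT.apply_eigenvectorBasis rfl j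
  have h2 := hS (hT.eigenvectorBasis rfl j) w
  have h3 : S (hT.eigenvectorBasis rfl j) = _ := h1
  rw [h3, inner_smul_left, hin] at h2
  have h4 := congrArg Complex.re h2
  rw [hre, RCLike.conj_ofReal] at h4
  rw [← h4, ← hre (b := g)]
  exact Complex.re_ofReal_mul _ _

/-! ### Hermitian metrics on complex manifolds -/

section HermitianMetric

variable {E : Type*} [NormedAddCommGroup E] [NormedSpace ℂ E]
  {X : Type*} [TopologicalSpace X] [ChartedSpace E X]

/-- The derivative at `x` of the change of coordinates from the preferred chart at `x` to the one
at `x₀`. -/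
noncomputable def transDeriv (x₀ x : X) : E →L[ℂ] E :=
  fderiv ℂ (chartAt E x₀ ∘ (chartAt E x).symm) (chartAt E x x)

theorem contDiffAt_coordChange [IsManifold 𝓘(ℂ, E) ω X] {x₀ x : X}
    (hx : x ∈ (chartAt E x₀).source) :
    ContDiffAt ℂ ω (chartAt E x₀ ∘ (chartAt E x).symm) (chartAt E x x) := by
  have h := (contDiffGroupoid ω 𝓘(ℂ, E)).compatible (chart_mem_atlas E x) (chart_mem_atlas E x₀)
  rw [contDiffGroupoid, mem_groupoid_of_pregroupoid] at h
  have h' : ContDiffOn ℂ ω (chartAt E x₀ ∘ (chartAt E x).symm)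
      ((chartAt E x).symm ≫ₕ chartAt E x₀).source := by
    simpa [contDiffPregroupoid] using h.1
  refine h'.contDiffAt (((chartAt E x).symm ≫ₕ chartAt E x₀).open_source.mem_nhds ?_)
  simp [hx]

variable [IsManifold 𝓘(ℂ, E) ω X]

/-- Tangent vectors at `x` are recorded in the preferred chart at `x`, which jumps with `x`.
Comparing forms at nearby points therefore requires the trivialization at a fixed `x₀`; here it is
identified with a complex-linear map. -/
theorem continuousLinearMapAt_eq_transDeriv {x₀ x : X} (hx : x ∈ (chartAt E x₀).source) (v : E) :
    (trivializationAt E (TangentSpace 𝓘(ℝ, E)) x₀).continuousLinearMapAt ℝ x v =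
      transDeriv x₀ x v := by
  rw [TangentBundle.continuousLinearMapAt_trivializationAt_eq_core hx,
    tangentBundleCore_coordChange_achart]
  have h := ((contDiffAt_coordChange hx).differentiableAt (by simp)).hasFDerivAt.restrictScalars ℝ
  simp only [extChartAt, OpenPartialHomeomorph.extend, modelWithCornersSelf_partialEquiv,
    PartialEquiv.trans_refl, modelWithCornersSelf_coe, range_id, fderivWithin_univ]
  exact congrArg (fun L : E →L[ℝ] E ↦ L v) h.fderiv

theorem hom_trivializationAt_transDeriv {x₀ x : X} (hx : x ∈ (chartAt E x₀).source)
    (φ : TangentSpace 𝓘(ℝ, E) x →L[ℝ] TangentSpace 𝓘(ℝ, E) x →L[ℝ] ℝ) (v w : E) :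
    (trivializationAt (E →L[ℝ] E →L[ℝ] ℝ) (fun x : X ↦
      TangentSpace 𝓘(ℝ, E) x →L[ℝ] TangentSpace 𝓘(ℝ, E) x →L[ℝ] ℝ) x₀ ⟨x, φ⟩).2
        (transDeriv x₀ x v) (transDeriv x₀ x w) = φ v w := by
  have hb : x ∈ (trivializationAt E (TangentSpace 𝓘(ℝ, E)) x₀).baseSet := hx
  rw [hom_trivializationAt_apply]
  have h := inCoordinates_apply_eq₂ (F₁ := E) (F₂ := E) (F₃ := ℝ)
    (E₁ := (TangentSpace 𝓘(ℝ, E) : X → Type _)) (E₂ := (TangentSpace 𝓘(ℝ, E) : X → Type _))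
    (E₃ := Bundle.Trivial X ℝ) (x₀ := x₀) (x := x) (ϕ := φ)
    (v := transDeriv x₀ x v) (w := transDeriv x₀ x w) hb hb (mem_univ _)
  refine h.trans ?_
  rw [← continuousLinearMapAt_eq_transDeriv hx, ← continuousLinearMapAt_eq_transDeriv hx]
  have hs : ∀ u : TangentSpace 𝓘(ℝ, E) x, (trivializationAt E (TangentSpace 𝓘(ℝ, E)) x₀).symm x
      ((trivializationAt E (TangentSpace 𝓘(ℝ, E)) x₀).continuousLinearMapAt ℝ x u) = u := by
    intro u
    have := (trivializationAt E (TangentSpace 𝓘(ℝ, E)) x₀).symmL_continuousLinearMapAt (R := ℝ) hb u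
    rwa [Bundle.Trivialization.symmL_apply _ hb] at this
  have h1 := hs v
  have h2 := hs w
  rw [h1, h2]
  simp

theorem transDeriv_bijective {x₀ x : X} (hx : x ∈ (chartAt E x₀).source) :
    Function.Bijective (transDeriv x₀ x : E → E) := by
  have hb : x ∈ (trivializationAt E (TangentSpace 𝓘(ℝ, E)) x₀).baseSet := hx
  constructor
  · intro v w h
    rw [← continuousLinearMapAt_eq_transDeriv hx, ← continuousLinearMapAt_eq_transDeriv hx] at h
    have h1 := (trivializationAt E (TangentSpace 𝓘(ℝ, E)) x₀).symmL_continuousLinearMapAt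
      (R := ℝ) hb v
    have h2 := (trivializationAt E (TangentSpace 𝓘(ℝ, E)) x₀).symmL_continuousLinearMapAt
      (R := ℝ) hb w
    rw [h] at h1
    exact h1.symm.trans h2
  · intro v
    refine ⟨(trivializationAt E (TangentSpace 𝓘(ℝ, E)) x₀).symmL ℝ x v, ?_⟩
    have h := (trivializationAt E (TangentSpace 𝓘(ℝ, E)) x₀).continuousLinearMapAt_symmL
      (R := ℝ) hb v
    exact (continuousLinearMapAt_eq_transDeriv hx _).symm.trans h

/-- A metric is bounded in a chart. -/
theorem HermitianMetric.eventually_le (g : HermitianMetric E X) (x₀ : X) :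
    ∃ C > 0, ∀ᶠ x in 𝓝 x₀, ∀ v : E, g.inner x v v ≤ C * ‖transDeriv x₀ x v‖ ^ 2 := by
  have h0 := ((Bundle.contMDiffAt_section x₀).1 g.contMDiff.contMDiffAt).continuousAt
  have h1 := (continuous_norm (E := E →L[ℝ] E →L[ℝ] ℝ)).continuousAt.comp h0
  obtain ⟨C, hC, h2⟩ : ∃ C > 0, ∀ᶠ x in 𝓝 x₀, ‖(trivializationAt (E →L[ℝ] E →L[ℝ] ℝ) (fun x : X ↦
      TangentSpace 𝓘(ℝ, E) x →L[ℝ] TangentSpace 𝓘(ℝ, E) x →L[ℝ] ℝ) x₀ ⟨x, g.inner x⟩).2‖ < C :=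
    ⟨_, lt_of_le_of_lt (norm_nonneg _) (lt_add_one _), h1.eventually (gt_mem_nhds (lt_add_one _))⟩
  refine ⟨C, hC, ?_⟩
  filter_upwards [h2, (chartAt E x₀).open_source.mem_nhds (mem_chart_source E x₀)] with x hx hxs v
  rw [← hom_trivializationAt_transDeriv hxs (g.inner x) v v]
  refine (Real.le_norm_self _).trans ((ContinuousLinearMap.le_opNorm₂ _ _ _).trans ?_)
  rw [mul_assoc, ← sq]
  gcongr

/-- By compactness the form has a positive minimum `m` on the unit sphere, so by homogeneity the set
lies in the ball of radius `1 / √m`. -/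
theorem isVonNBounded_of_pos [FiniteDimensional ℂ E] (B : E →L[ℝ] E →L[ℝ] ℝ)
    (hB : ∀ v, v ≠ 0 → 0 < B v v) : Bornology.IsVonNBounded ℝ {v : E | B v v < 1} := by
  have : ProperSpace E := FiniteDimensional.proper ℂ E
  rw [NormedSpace.isVonNBounded_iff]
  have hc : Continuous fun v : E ↦ B v v := B.continuous₂.comp (continuous_id.prodMk continuous_id)
  rcases subsingleton_or_nontrivial E with hE | hE
  · exact (Set.toFinite _).isBounded
  obtain ⟨u, hu, hmin⟩ := (isCompact_sphere (0 : E) 1).exists_isMinOn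
    (NormedSpace.sphere_nonempty.2 zero_le_one) hc.continuousOn
  have hu0 : u ≠ 0 := by
    rintro rfl
    simp at hu
  have hm := hB u hu0
  refine Metric.isBounded_iff_subset_closedBall (0 : E) |>.2 ⟨√(1 / B u u), fun v hv ↦ ?_⟩
  rw [mem_closedBall_zero_iff]
  apply Real.le_sqrt_of_sq_le
  rw [le_div_iff₀ hm]
  rcases eq_or_ne v 0 with rfl | hv0
  · simp
  have hnv : 0 < ‖v‖ := norm_pos_iff.2 hv0
  have h1 : B u u ≤ B (‖v‖⁻¹ • v) (‖v‖⁻¹ • v) := hmin (by simp [norm_smul, hnv.ne'])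
  simp only [map_smul, smul_apply, smul_eq_mul] at h1
  have h2 : ‖v‖ ^ 2 * B u u ≤ B v v := by
    calc ‖v‖ ^ 2 * B u u ≤ ‖v‖ ^ 2 * (‖v‖⁻¹ * (‖v‖⁻¹ * B v v)) := by gcongr
      _ = B v v := by field_simp
  exact h2.trans hv.le

set_option synthInstance.maxHeartbeats 400000 in
set_option maxHeartbeats 1000000 in
-- Symmetric, positive definite, `i`-invariant forms on a tangent space form a convex set, so local
-- metrics glue by a partition of unity. Locally `B` is pulled back by `transDeriv`, whose complex
-- linearity preserves `i`-invariance.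
theorem exists_hermitianMetric [FiniteDimensional ℂ E] [T2Space X] [SigmaCompactSpace X]
    (B : E →L[ℝ] E →L[ℝ] ℝ) (hsymm : ∀ v w, B v w = B w v) (hpos : ∀ v, v ≠ 0 → 0 < B v v)
    (hI : ∀ v w, B (Complex.I • v) (Complex.I • w) = B v w) :
    Nonempty (HermitianMetric E X) := by
  have : FiniteDimensional ℝ E := FiniteDimensional.complexToReal E
  let t : ∀ x : X, Set (TangentSpace 𝓘(ℝ, E) x →L[ℝ] TangentSpace 𝓘(ℝ, E) x →L[ℝ] ℝ) := fun x ↦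
    {φ | (∀ v w : E, φ v w = φ w v) ∧ (∀ v : E, v ≠ 0 → 0 < φ v v) ∧
      ∀ v w : E, φ (Complex.I • v : E) (Complex.I • w : E) = φ v w}
  have ht : ∀ x, Convex ℝ (t x) := by
    rintro x φ ⟨h1, h2, h3⟩ ψ ⟨k1, k2, k3⟩ a b ha hb hab
    have e : ∀ v w : E, (a • φ + b • ψ) v w = a * φ v w + b * ψ v w := fun v w ↦ rfl
    refine ⟨fun v w ↦ ?_, fun v hv ↦ ?_, fun v w ↦ ?_⟩
    · rw [e, e, h1, k1]
    · rw [e]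
      have := h2 v hv
      have := k2 v hv
      rcases ha.eq_or_lt with rfl | ha
      · rw [zero_add] at hab; subst hab; simpa
      · positivity
    · rw [e, e, h3, k3]
  have hloc : ∀ x₀ : X, ∃ U ∈ 𝓝 x₀, ∃ s : (x : X) →
      (TangentSpace 𝓘(ℝ, E) x →L[ℝ] TangentSpace 𝓘(ℝ, E) x →L[ℝ] ℝ),
      ContMDiffOn 𝓘(ℝ, E) (𝓘(ℝ, E).prod 𝓘(ℝ, E →L[ℝ] E →L[ℝ] ℝ)) (⊤ : ℕ∞)
        (fun x ↦ Bundle.TotalSpace.mk' (E →L[ℝ] E →L[ℝ] ℝ) x (s x)) U ∧ ∀ y ∈ U, s y ∈ t y := by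
    intro x₀
    let s : (x : X) → (TangentSpace 𝓘(ℝ, E) x →L[ℝ] TangentSpace 𝓘(ℝ, E) x →L[ℝ] ℝ) := fun x ↦
      B.bilinearComp ((transDeriv x₀ x).restrictScalars ℝ) ((transDeriv x₀ x).restrictScalars ℝ)
    refine ⟨(chartAt E x₀).source, (chartAt E x₀).open_source.mem_nhds (mem_chart_source E x₀),
      s, ?_, ?_⟩
    · have hs := Bundle.Trivialization.contMDiffOn_section_iff (F := E →L[ℝ] E →L[ℝ] ℝ)
        (IB := 𝓘(ℝ, E)) (n := (⊤ : ℕ∞)) (s := s)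
        (trivializationAt (E →L[ℝ] E →L[ℝ] ℝ) (fun x : X ↦
        TangentSpace 𝓘(ℝ, E) x →L[ℝ] TangentSpace 𝓘(ℝ, E) x →L[ℝ] ℝ) x₀)
        (chartAt E x₀).open_source (by intro x hx; exact ⟨hx, hx, mem_univ _⟩)
      -- Read in the trivialization at `x₀`, the pulled-back form is the constant `B`, hence smooth.
      refine hs.2 ((contMDiffOn_const (c := B)).congr fun x hx ↦ ?_)
      ext v w
      obtain ⟨v, rfl⟩ := (transDeriv_bijective hx).2 v
      obtain ⟨w, rfl⟩ := (transDeriv_bijective hx).2 w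
      rw [hom_trivializationAt_transDeriv hx]
      rfl
    · intro x hx
      refine ⟨fun v w ↦ hsymm _ _, fun v hv ↦ hpos _ fun h ↦ hv ?_, fun v w ↦ ?_⟩
      · exact (transDeriv_bijective hx).1 (h.trans (map_zero _).symm)
      · show B (transDeriv x₀ x (Complex.I • v)) (transDeriv x₀ x (Complex.I • w)) =
          B (transDeriv x₀ x v) (transDeriv x₀ x w)
        rw [(transDeriv x₀ x).map_smul, (transDeriv x₀ x).map_smul, hI]
  obtain ⟨s, hs⟩ := exists_contMDiffSection_forall_mem_convex_of_local 𝓘(ℝ, E)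
    (fun x : X ↦ TangentSpace 𝓘(ℝ, E) x →L[ℝ] TangentSpace 𝓘(ℝ, E) x →L[ℝ] ℝ) t ht hloc
  exact ⟨{ inner := s
           symm := fun x ↦ (hs x).1
           pos := fun x ↦ (hs x).2.1
           isVonNBounded := fun x ↦ isVonNBounded_of_pos (E := E) (show E →L[ℝ] E →L[ℝ] ℝ from s x) (hs x).2.1
           contMDiff := s.contMDiff
           inner_I := fun x ↦ (hs x).2.2 }⟩

/-- A positive multiple of a Hermitian metric. -/
noncomputable def HermitianMetric.scale [FiniteDimensional ℂ E] (g : HermitianMetric E X) (c : ℝ)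
    (hc : 0 < c) : HermitianMetric E X where
  inner x := c • g.inner x
  symm x v w := congrArg (c * ·) (g.symm x v w)
  pos x v hv := mul_pos hc (g.pos x v hv)
  isVonNBounded x := isVonNBounded_of_pos (E := E) (c • g.inner x) fun v hv ↦
    mul_pos hc (g.pos x v hv)
  contMDiff := contMDiff_const.smul_section g.contMDiff
  inner_I x v w := congrArg (c * ·) (g.inner_I x v w)

theorem HermitianMetric.scale_apply [FiniteDimensional ℂ E] (g : HermitianMetric E X) {c : ℝ}
    (hc : 0 < c) (x : X) (v w : E) : (g.scale c hc).inner x v w = c * g.inner x v w := rfl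

theorem HermitianMetric.isHermitianRe (g : HermitianMetric E X) (x : X) :
    IsHermitianRe (V := E) (fun v w ↦ g.inner x v w) where
  symm v w := g.symm x v w
  add_right v w w' := map_add _ _ _
  smul_right v w c := by
    rw [Complex.coe_smul]
    exact map_smul (g.inner x v) c w
  inv_I v w := g.inner_I x v w

end HermitianMetric

/-! ### The potential `-log (discGap h ζ)` and its Levi form -/

/-- `1` minus the squared pseudo-hyperbolic distance from `h` to `ζ`. -/
noncomputable def discGap (h ζ : ℂ) : ℝ :=
  (1 - ‖h‖ ^ 2) * (1 - ‖ζ‖ ^ 2) / ‖1 - conj h * ζ‖ ^ 2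

/-- Since `|h̄ζ| < 1`, the number lies in the open unit disc about `1`, where the principal
logarithm is holomorphic. Allowing `‖ζ‖ = 1` covers the boundary of `D`. -/
theorem one_sub_conj_mul_mem_slitPlane {h ζ : ℂ} (hh : ‖h‖ < 1) (hζ : ‖ζ‖ ≤ 1) :
    1 - conj h * ζ ∈ Complex.slitPlane := by
  rw [sub_eq_add_neg]
  apply Complex.mem_slitPlane_of_norm_lt_one
  rw [norm_neg, norm_mul, RCLike.norm_conj]
  nlinarith [norm_nonneg h, norm_nonneg ζ]

theorem one_sub_conj_mul_ne_zero {h ζ : ℂ} (hh : ‖h‖ < 1) (hζ : ‖ζ‖ ≤ 1) :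
    1 - conj h * ζ ≠ 0 :=
  Complex.slitPlane_ne_zero (one_sub_conj_mul_mem_slitPlane hh hζ)

theorem discGap_pos {h ζ : ℂ} (hh : ‖h‖ < 1) (hζ : ‖ζ‖ < 1) : 0 < discGap h ζ := by
  have h1 : 0 < ‖1 - conj h * ζ‖ := norm_pos_iff.2 (one_sub_conj_mul_ne_zero hh hζ.le)
  have h2 : 0 < 1 - ‖h‖ ^ 2 := by nlinarith [norm_nonneg h]
  have h3 : 0 < 1 - ‖ζ‖ ^ 2 := by nlinarith [norm_nonneg ζ]
  unfold discGap
  positivity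

/-- The potential is split into principal logarithms of polynomials in `h`, `ζ` and their
conjugates, to which the rules for `HasWirtinger` apply. -/
theorem ofReal_neg_log_discGap {h ζ : ℂ} (hh : ‖h‖ < 1) (hζ : ‖ζ‖ < 1) :
    ((-Real.log (discGap h ζ) : ℝ) : ℂ) = Complex.log (1 - conj h * ζ) +
      conj (Complex.log (1 - conj h * ζ)) - Complex.log (1 - h * conj h) -
        Complex.log (1 - ζ * conj ζ) := by
  have h1 := one_sub_conj_mul_mem_slitPlane hh hζ.le
  have h1' : 0 < ‖1 - conj h * ζ‖ := norm_pos_iff.2 (one_sub_conj_mul_ne_zero hh hζ.le)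
  have h2 : 0 < 1 - ‖h‖ ^ 2 := by nlinarith [norm_nonneg h]
  have h3 : 0 < 1 - ‖ζ‖ ^ 2 := by nlinarith [norm_nonneg ζ]
  have e1 : Complex.log (1 - conj h * ζ) + conj (Complex.log (1 - conj h * ζ)) =
      ((2 * Real.log ‖1 - conj h * ζ‖ : ℝ) : ℂ) := by
    rw [Complex.add_conj, Complex.log_re]
  have e2 : ∀ {x : ℂ}, 0 < 1 - ‖x‖ ^ 2 →
      Complex.log (1 - x * conj x) = ((Real.log (1 - ‖x‖ ^ 2) : ℝ) : ℂ) := by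
    intro x hx
    rw [Complex.ofReal_log hx.le, Complex.mul_conj, Complex.normSq_eq_norm_sq]
    push_cast
    rfl
  rw [e1, e2 h2, e2 h3, discGap, Real.log_div (by positivity) (by positivity),
    Real.log_mul h2.ne' h3.ne', Real.log_pow]
  push_cast
  ring

theorem HasWirtinger.of_contDiffAt {X : ℂ → ℂ} {t : ℂ} (hX : ContDiffAt ℝ 2 X t) :
    HasWirtinger X t (X t) (_root_.wirtinger X t) (_root_.wirtingerBar X t)
      (_root_.wirtinger (_root_.wirtingerBar X) t) :=
  ⟨hX, rfl, rfl, rfl, rfl⟩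

theorem HasWirtinger.id (t : ℂ) : HasWirtinger (fun u ↦ u) t t 1 0 0 := by
  have h1 : _root_.wirtingerBar (fun u : ℂ ↦ u) = fun _ ↦ 0 := by
    funext u
    have : fderiv ℝ (fun u : ℂ ↦ u) u = ContinuousLinearMap.id ℝ ℂ := fderiv_id
    simp [_root_.wirtingerBar, this]
  refine ⟨contDiffAt_id, rfl, ?_, by rw [h1], by rw [h1]; simp [_root_.wirtinger]⟩
  have : fderiv ℝ (fun u : ℂ ↦ u) t = ContinuousLinearMap.id ℝ ℂ := fderiv_id
  simp [_root_.wirtinger, this]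

theorem HasWirtinger.mixed_congr {X : ℂ → ℂ} {t x x1 x2 d d' : ℂ}
    (hX : HasWirtinger X t x x1 x2 d) (h : d = d') : HasWirtinger X t x x1 x2 d' := h ▸ hX

theorem norm_sq_sub_div (h ζ : ℂ) (hM : 1 - conj h * ζ ≠ 0) :
    1 - ‖(ζ - h) / (1 - conj h * ζ)‖ ^ 2 = discGap h ζ := by
  have h1 : ‖1 - conj h * ζ‖ ^ 2 ≠ 0 := by simpa using hM
  rw [norm_div, div_pow, discGap, eq_div_iff h1, sub_mul, div_mul_cancel₀ _ h1, one_mul]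
  simp only [← Complex.normSq_eq_norm_sq, Complex.normSq_apply]
  simp
  ring

/-- The mixed second derivative along a complex line of
`-log (discGap h ζ)`, for a harmonic map `h` into the disc. -/
theorem hasWirtinger_neg_log_discGap {h : ℂ → ℂ} {z ζ h₀ a b m : ℂ}
    (hh : HasWirtinger h z h₀ a b m)
    (hm : m + 2 * conj h₀ / (1 - (‖h₀‖ : ℂ) ^ 2) * a * b = 0)
    (h1 : ‖h₀‖ < 1) (hζ : ‖ζ‖ < 1) (v : ℂ × ℂ) :
    ∃ x x1 x2, HasWirtinger
      (fun t : ℂ ↦ ((-Real.log (discGap (h (z + t * v.1)) (ζ + t * v.2)) : ℝ) : ℂ)) 0 x x1 x2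
      ((a * conj a + b * conj b
          - conj a * conj b * (ζ - h₀) ^ 2 / (1 - conj h₀ * ζ) ^ 2
          - a * b * (conj ζ - conj h₀) ^ 2 / (1 - h₀ * conj ζ) ^ 2) / (1 - h₀ * conj h₀) ^ 2
          * (v.1 * conj v.1)
        - conj a / (1 - conj h₀ * ζ) ^ 2 * (v.2 * conj v.1)
        - a / (1 - h₀ * conj ζ) ^ 2 * (v.1 * conj v.2)
        + v.2 * conj v.2 / (1 - ζ * conj ζ) ^ 2) := by
  have hH := hh.comp_line v.1
  have hZ := (HasWirtinger.id ζ).comp_line v.2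
  have hM := (HasWirtinger.const 1 0).sub (hH.conj_comp.mul hZ)
  have hN := (HasWirtinger.const 1 0).sub (hH.mul hH.conj_comp)
  have hD := (HasWirtinger.const 1 0).sub (hZ.mul hZ.conj_comp)
  have sM := one_sub_conj_mul_mem_slitPlane h1 hζ.le
  have real : ∀ {x : ℂ}, ‖x‖ < 1 → 1 - x * conj x ∈ Complex.slitPlane := by
    intro x hx
    rw [mul_comm]
    exact one_sub_conj_mul_mem_slitPlane hx hx.le
  have hlM := hM.log sM
  have hlN := hN.log (real h1)
  have hlD := hD.log (real hζ)
  have htot := ((hlM.add hlM.conj_comp).sub hlN).sub hlD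
  have hev : (fun t : ℂ ↦ ((-Real.log (discGap (h (z + t * v.1)) (ζ + t * v.2)) : ℝ) : ℂ)) =ᶠ[𝓝 0]
      fun t ↦ Complex.log (1 - conj (h (z + t * v.1)) * (ζ + t * v.2)) +
        conj (Complex.log (1 - conj (h (z + t * v.1)) * (ζ + t * v.2))) -
        Complex.log (1 - h (z + t * v.1) * conj (h (z + t * v.1))) -
        Complex.log (1 - (ζ + t * v.2) * conj (ζ + t * v.2)) := by
    have c1 : ∀ᶠ t in 𝓝 (0 : ℂ), ‖h (z + t * v.1)‖ < 1 :=
      hH.contDiffAt.continuousAt.norm.eventually (gt_mem_nhds (by simpa [hh.value] using h1))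
    have c2 : ∀ᶠ t in 𝓝 (0 : ℂ), ‖ζ + t * v.2‖ < 1 :=
      hZ.contDiffAt.continuousAt.norm.eventually (gt_mem_nhds (by simpa using hζ))
    filter_upwards [c1, c2] with t ht1 ht2 using ofReal_neg_log_discGap ht1 ht2
  have nM := Complex.slitPlane_ne_zero sM
  have nN := Complex.slitPlane_ne_zero (real h1)
  have nD := Complex.slitPlane_ne_zero (real hζ)
  have nMc : 1 - h₀ * conj ζ ≠ 0 := by
    have := (map_ne_zero (starRingEnd ℂ)).2 nM
    simpa using this
  have hN' : (1 : ℂ) - (‖h₀‖ : ℂ) ^ 2 = 1 - h₀ * conj h₀ := by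
    rw [Complex.mul_conj, Complex.normSq_eq_norm_sq]; push_cast; rfl
  -- The harmonic map equation enters here: it eliminates the second derivative `h_{z z̄}` from the
  -- Levi form.
  have em : m = -(2 * conj h₀ * a * b / (1 - h₀ * conj h₀)) := by
    rw [hN'] at hm
    linear_combination hm
  refine ⟨_, _, _, (htot.congr hev).mixed_congr ?_⟩
  rw [em]
  simp only [map_neg, map_sub, map_add, map_mul, map_div₀, Complex.conj_conj, map_one, map_zero,
    map_ofNat]
  have nD' := nD
  have nN' := nN
  rw [mul_comm ζ] at nD'
  rw [mul_comm h₀] at nN'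
  -- With conjugates treated as independent variables, what remains is an identity of rational
  -- functions.
  generalize conj h₀ = hb at *
  generalize conj ζ = ζb at *
  generalize conj a = ab at *
  generalize conj b = bb at *
  generalize conj v.1 = vb at *
  generalize conj v.2 = wb at *
  generalize v.1 = v1 at *
  generalize v.2 = v2 at *
  clear hm em hN' hev htot hlM hlN hlD hM hN hD hH hZ real sM
  field_simp
  ring

theorem contDiffAt_discGap {E : Type*} [NormedAddCommGroup E] [NormedSpace ℝ E] {f g : E → ℂ}
    {x : E} (hf : ContDiffAt ℝ 2 f x) (hg : ContDiffAt ℝ 2 g x) (hne : 1 - conj (f x) * g x ≠ 0) :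
    ContDiffAt ℝ 2 (fun y ↦ discGap (f y) (g y)) x := by
  have hc : ContDiffAt ℝ 2 (fun y ↦ conj (f y)) x :=
    Complex.conjCLE.contDiff.contDiffAt.comp x hf
  have h1 : ContDiffAt ℝ 2 (fun y ↦ 1 - ‖f y‖ ^ 2) x := contDiffAt_const.sub (hf.norm_sq ℝ)
  have h2 : ContDiffAt ℝ 2 (fun y ↦ 1 - ‖g y‖ ^ 2) x := contDiffAt_const.sub (hg.norm_sq ℝ)
  have h3 : ContDiffAt ℝ 2 (fun y ↦ ‖1 - conj (f y) * g y‖ ^ 2) x :=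
    (contDiffAt_const.sub (hc.mul hg)).norm_sq ℝ
  exact (h1.mul h2).div h3 (by simpa using hne)

/-- A lower bound for the coefficient of `|dz|²` in the Levi form of `-log (discGap h ζ)`, in terms
of the Wirtinger derivatives `a`, `b` of `h` and of the squared pseudo-hyperbolic distance `ρ`. -/
noncomputable def leviCoeff (a b : ℂ) (ρ : ℝ) : ℝ :=
  ‖a‖ ^ 2 + ‖b‖ ^ 2 - 2 * ‖a‖ * ‖b‖ * ρ - 2 * (1 - ρ) ^ 2 * ‖a‖ ^ 2

/-- The coefficient equals `(|b| - ρ|a|)² + (1 - ρ)(3ρ - 1)|a|²`, which explains the threshold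
`1/3`. -/
theorem leviCoeff_nonneg (a b : ℂ) {ρ : ℝ} (h1 : 1 / 3 ≤ ρ) (h2 : ρ ≤ 1) :
    0 ≤ leviCoeff a b ρ := by
  unfold leviCoeff
  nlinarith [sq_nonneg (‖b‖ - ρ * ‖a‖), mul_nonneg (mul_nonneg (sub_nonneg.2 h1) (sub_nonneg.2 h2))
    (sq_nonneg ‖a‖)]

/-- Put `N = 1 - |h|²`, `δ = 1 - |ζ|²`, `x = |v₁| / N` and `y = |v₂| / δ`. The form is at least
`(|a|² + |b|² - 2|a||b|ρ) x² - 2|a|(1 - ρ) x y + y²`. Half of `y²` absorbs the mixed term at the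
cost of `2(1 - ρ)²|a|² x²`. Finally `|v₁| ≤ x` and `|v₂| ≤ y`; nonnegativity of the coefficient is
used to replace `x` by `|v₁|`. -/
theorem re_leviExpr_ge {a b h ζ v₁ v₂ : ℂ} (hh : ‖h‖ < 1) (hζ : ‖ζ‖ < 1)
    (hκ : 0 ≤ leviCoeff a b (1 - discGap h ζ)) :
    leviCoeff a b (1 - discGap h ζ) * ‖v₁‖ ^ 2 + ‖v₂‖ ^ 2 / 2 ≤
      ((a * conj a + b * conj b
          - conj a * conj b * (ζ - h) ^ 2 / (1 - conj h * ζ) ^ 2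
          - a * b * (conj ζ - conj h) ^ 2 / (1 - h * conj ζ) ^ 2) / (1 - h * conj h) ^ 2
          * (v₁ * conj v₁)
        - conj a / (1 - conj h * ζ) ^ 2 * (v₂ * conj v₁)
        - a / (1 - h * conj ζ) ^ 2 * (v₁ * conj v₂)
        + v₂ * conj v₂ / (1 - ζ * conj ζ) ^ 2).re := by
  have nM := one_sub_conj_mul_ne_zero hh hζ.le
  set W : ℂ := conj a * conj b * (ζ - h) ^ 2 / (1 - conj h * ζ) ^ 2 with hW
  set V : ℂ := conj a / (1 - conj h * ζ) ^ 2 * (v₂ * conj v₁) with hV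
  have cW : a * b * (conj ζ - conj h) ^ 2 / (1 - h * conj ζ) ^ 2 = conj W := by simp [hW]
  have cV : a / (1 - h * conj ζ) ^ 2 * (v₁ * conj v₂) = conj V := by simp [hV, mul_comm]
  have sq : ∀ x : ℂ, x * conj x = ((‖x‖ ^ 2 : ℝ) : ℂ) := fun x ↦ by
    rw [Complex.mul_conj, Complex.normSq_eq_norm_sq]
  set N : ℝ := 1 - ‖h‖ ^ 2 with hN
  set δ : ℝ := 1 - ‖ζ‖ ^ 2 with hδ
  have N0 : 0 < N := by rw [hN]; nlinarith [norm_nonneg h]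
  have δ0 : 0 < δ := by rw [hδ]; nlinarith [norm_nonneg ζ]
  have N1 : N ≤ 1 := by rw [hN]; nlinarith [norm_nonneg h]
  have δ1 : δ ≤ 1 := by rw [hδ]; nlinarith [norm_nonneg ζ]
  have e : (a * conj a + b * conj b - W - conj W) / (1 - h * conj h) ^ 2 * (v₁ * conj v₁) - V
      - conj V + v₂ * conj v₂ / (1 - ζ * conj ζ) ^ 2 =
      (((‖a‖ ^ 2 + ‖b‖ ^ 2 - 2 * W.re) / N ^ 2 * ‖v₁‖ ^ 2 - 2 * V.re + ‖v₂‖ ^ 2 / δ ^ 2 : ℝ) : ℂ) := by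
    have w1 : W + conj W = ((2 * W.re : ℝ) : ℂ) := Complex.add_conj W
    have w2 : V + conj V = ((2 * V.re : ℝ) : ℂ) := Complex.add_conj V
    rw [sq, sq, sq, sq, sq, sq, sub_sub _ W, sub_sub _ V, w1, w2, hN, hδ]
    push_cast
    ring
  rw [cW, cV, e, Complex.ofReal_re]
  set ρ : ℝ := 1 - discGap h ζ with hρ
  have hρ' : ρ = ‖(ζ - h) / (1 - conj h * ζ)‖ ^ 2 := by
    rw [hρ, ← norm_sq_sub_div h ζ nM]; ring
  set μ := ‖1 - conj h * ζ‖ with hμ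
  have μ0 : 0 < μ := norm_pos_iff.2 nM
  have bW : W.re ≤ ‖a‖ * ‖b‖ * ρ := by
    refine (Complex.re_le_norm W).trans (le_of_eq ?_)
    simp only [hW, hρ', norm_div, norm_mul, norm_pow, RCLike.norm_conj]
    ring
  have gap : discGap h ζ = 1 - ρ := by rw [hρ]; ring
  -- By definition of the gap, `1 / |1 - h̄ζ|² = (1 - ρ) / (N δ)`. The factor `1 - ρ` makes the
  -- mixed term small near the boundary.
  have bV : V.re ≤ ‖a‖ * (1 - ρ) * (‖v₁‖ / N) * (‖v₂‖ / δ) := by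
    refine (Complex.re_le_norm V).trans (le_of_eq ?_)
    rw [← gap]
    simp only [hV, norm_div, norm_mul, norm_pow, RCLike.norm_conj, discGap, ← hN, ← hδ, ← hμ]
    field_simp
  set x := ‖v₁‖ / N with hx
  set y := ‖v₂‖ / δ with hy
  have x1 : ‖v₁‖ ≤ x := by rw [hx, le_div_iff₀ N0]; nlinarith [norm_nonneg v₁]
  have y1 : ‖v₂‖ ≤ y := by rw [hy, le_div_iff₀ δ0]; nlinarith [norm_nonneg v₂]
  have ex : (‖a‖ ^ 2 + ‖b‖ ^ 2 - 2 * W.re) / N ^ 2 * ‖v₁‖ ^ 2 =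
      (‖a‖ ^ 2 + ‖b‖ ^ 2 - 2 * W.re) * x ^ 2 := by rw [hx, div_pow]; ring
  have ey : ‖v₂‖ ^ 2 / δ ^ 2 = y ^ 2 := by rw [hy, div_pow]
  rw [ex, ey]
  have s1 : leviCoeff a b ρ * ‖v₁‖ ^ 2 ≤ leviCoeff a b ρ * x ^ 2 := by gcongr
  have s2 : ‖v₂‖ ^ 2 ≤ y ^ 2 := by gcongr
  have s3 : W.re * x ^ 2 ≤ ‖a‖ * ‖b‖ * ρ * x ^ 2 := by gcongr
  -- Half of this square gives `2|a|(1 - ρ) x y ≤ 2|a|²(1 - ρ)² x² + y² / 2`.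
  have s4 := sq_nonneg (2 * ‖a‖ * (1 - ρ) * x - y)
  unfold leviCoeff at s1 ⊢
  nlinarith

/-- The weight depends on the base variable alone, so it contributes exactly `ε ψ_{z z̄} |v₁|²` to
the bound of `re_leviExpr_ge`. -/
theorem flatLevi_discPotential_ge {h : ℂ → ℂ} {ψ : ℂ → ℝ} {z ζ : ℂ} {ε : ℝ}
    (hh : ContDiffAt ℝ 2 h z)
    (harm : wirtinger (wirtingerBar h) z + 2 * conj (h z) / (1 - (‖h z‖ : ℂ) ^ 2) *
      wirtinger h z * wirtingerBar h z = 0)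
    (hψ : ContDiffAt ℝ 2 ψ z) (h1 : ‖h z‖ < 1) (hζ : ‖ζ‖ < 1)
    (hκ : 0 ≤ leviCoeff (wirtinger h z) (wirtingerBar h z) (1 - discGap (h z) ζ)) (v : ℂ × ℂ) :
    (leviCoeff (wirtinger h z) (wirtingerBar h z) (1 - discGap (h z) ζ) +
      ε * (wirtinger (wirtingerBar fun u ↦ (ψ u : ℂ)) z).re) * ‖v.1‖ ^ 2 + ‖v.2‖ ^ 2 / 2 ≤
    flatLevi (fun q : ℂ × ℂ ↦ ε * ψ q.1 - Real.log (discGap (h q.1) q.2)) (z, ζ) v v := by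
  have hF : ContDiffAt ℝ 2 (fun q : ℂ × ℂ ↦ ε * ψ q.1 - Real.log (discGap (h q.1) q.2)) (z, ζ) := by
    have hψ' : ContDiffAt ℝ 2 (fun q : ℂ × ℂ ↦ ψ q.1) (z, ζ) :=
      ContDiffAt.comp (g := ψ) (z, ζ) hψ contDiffAt_fst
    have hh' : ContDiffAt ℝ 2 (fun q : ℂ × ℂ ↦ h q.1) (z, ζ) :=
      ContDiffAt.comp (g := h) (z, ζ) hh contDiffAt_fst
    exact (contDiffAt_const.mul hψ').sub ((contDiffAt_discGap hh' contDiffAt_snd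
      (one_sub_conj_mul_ne_zero h1 hζ.le)).log (discGap_pos h1 hζ).ne')
  have hψc : ContDiffAt ℝ 2 (fun u ↦ (ψ u : ℂ)) z :=
    Complex.ofRealCLM.contDiff.contDiffAt.comp z hψ
  obtain ⟨x, x1, x2, hx⟩ := hasWirtinger_neg_log_discGap (HasWirtinger.of_contDiffAt hh) harm h1 hζ v
  have hp := (HasWirtinger.const (ε : ℂ) 0).mul ((HasWirtinger.of_contDiffAt hψc).comp_line v.1)
  have key := flatLevi_eq_of_hasWirtinger hF (v := v) ((hp.add hx).congr
    (Filter.Eventually.of_forall fun t ↦ by simp [sub_eq_add_neg]))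
  rw [key, Complex.add_re]
  have hre := re_leviExpr_ge (v₁ := v.1) (v₂ := v.2) h1 hζ hκ
  have hq : ((ε : ℂ) * (v.1 * conj v.1 * wirtinger (wirtingerBar fun u ↦ (ψ u : ℂ)) z)).re =
      ε * (wirtinger (wirtingerBar fun u ↦ (ψ u : ℂ)) z).re * ‖v.1‖ ^ 2 := by
    rw [Complex.mul_conj, Complex.re_ofReal_mul, Complex.re_ofReal_mul, Complex.normSq_eq_norm_sq]
    ring
  simp only [zero_mul, add_zero]
  rw [hq]
  linarith

/-- The differential is `v ↦ a v + b v̄`, with Jacobian `|a|² - |b|²`. If `|a| = |b|`, it kills both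
`ā - b` and `i(ā + b)`; injectivity makes these zero, hence `a = b = 0`, which is absurd. -/
theorem norm_wirtinger_ne_norm_wirtingerBar {h : ℂ → ℂ} {z : ℂ}
    (hs : Function.Surjective (fderiv ℝ h z)) : ‖wirtinger h z‖ ≠ ‖wirtingerBar h z‖ := by
  intro heq
  have hinj : Function.Injective (fderiv ℝ h z) :=
    (LinearMap.injective_iff_surjective (f := (fderiv ℝ h z).toLinearMap)).2 hs
  set a := wirtinger h z with ha
  set b := wirtingerBar h z with hb
  have hL : ∀ v, fderiv ℝ h z v = a * v + b * conj v := by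
    intro v
    conv_lhs => rw [← Complex.re_add_im v, map_add, ← mul_one (v.re : ℂ), ← Complex.real_smul,
      ← Complex.real_smul, map_smul, map_smul]
    have e2 : conj v = v.re - v.im * Complex.I := by apply Complex.ext <;> simp
    rw [e2]
    simp only [ha, hb, wirtinger, wirtingerBar, Complex.real_smul]
    linear_combination (v.im : ℂ) * fderiv ℝ h z Complex.I * Complex.I_sq +
      (fderiv ℝ h z 1 - Complex.I * fderiv ℝ h z Complex.I) / 2 * Complex.re_add_im v
  have hab : a * conj a = b * conj b := by
    rw [Complex.mul_conj, Complex.mul_conj, Complex.normSq_eq_norm_sq, Complex.normSq_eq_norm_sq,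
      heq]
  have k1 : conj a - b = 0 := hinj (by
    rw [map_zero, hL, map_sub, Complex.conj_conj]
    linear_combination hab)
  have k2 : Complex.I * (conj a + b) = 0 := hinj (by
    rw [map_zero, hL, map_mul, map_add, Complex.conj_conj, Complex.conj_I]
    linear_combination Complex.I * hab)
  have k3 : conj a + b = 0 := by simpa using k2
  have k4 : conj a = 0 := by linear_combination (k1 + k3) / 2
  have k5 : b = 0 := by linear_combination (k3 - k1) / 2
  have k6 : a = 0 := by simpa using k4
  have : (1 : ℂ) = 0 := hinj (by rw [hL, hL, k5, k6]; simp)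
  exact one_ne_zero this

/-! ### Invariance of the gap under disc automorphisms -/

/-- The kernel `1 - h̄ζ` changes only by a factor that splits between `h` and `ζ`. In the quotient
defining `discGap` these factors cancel against those on the diagonal. -/
theorem one_sub_conj_mul_discAut {e a h ζ : ℂ} (he : conj e * e = 1) (h1 : conj a * h - 1 ≠ 0)
    (h2 : conj a * ζ - 1 ≠ 0) :
    1 - conj (e * (h - a) / (conj a * h - 1)) * (e * (ζ - a) / (conj a * ζ - 1)) =
      (1 - a * conj a) * (1 - conj h * ζ) / (conj (conj a * h - 1) * (conj a * ζ - 1)) := by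
  have h1' : a * conj h - 1 ≠ 0 := by
    have := (map_ne_zero (starRingEnd ℂ)).2 h1
    simpa using this
  have h1'' := h1'
  rw [mul_comm] at h1''
  simp only [map_div₀, map_mul, map_sub, map_one, Complex.conj_conj]
  generalize conj a = ab at *
  generalize conj h = hb at *
  generalize conj e = eb at *
  field_simp
  linear_combination -(hb - ab) * (ζ - a) * he

theorem one_sub_norm_sq_eq (x : ℂ) : 1 - ‖x‖ ^ 2 = ‖1 - conj x * x‖ ∨ 1 < ‖x‖ := by
  rcases le_or_gt ‖x‖ 1 with h | h
  · left
    have : 1 - conj x * x = ((1 - ‖x‖ ^ 2 : ℝ) : ℂ) := by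
      rw [mul_comm, Complex.mul_conj, Complex.normSq_eq_norm_sq]; push_cast; rfl
    rw [this, Complex.norm_real, Real.norm_of_nonneg]
    nlinarith [norm_nonneg x]
  · exact Or.inr h

theorem one_sub_norm_sq_discAut {e a ζ : ℂ} (he : conj e * e = 1) (h2 : conj a * ζ - 1 ≠ 0) :
    1 - ‖e * (ζ - a) / (conj a * ζ - 1)‖ ^ 2 =
      (1 - ‖a‖ ^ 2) * (1 - ‖ζ‖ ^ 2) / ‖conj a * ζ - 1‖ ^ 2 := by
  have key := one_sub_conj_mul_discAut he h2 h2
  rw [mul_comm (conj _) (_ / _), Complex.mul_conj, mul_comm (conj ζ), Complex.mul_conj,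
    Complex.mul_conj, mul_comm (conj _) (conj a * ζ - 1), Complex.mul_conj] at key
  simp only [Complex.normSq_eq_norm_sq] at key
  exact_mod_cast key

theorem conj_mul_sub_one_ne_zero {a h : ℂ} (ha : ‖a‖ < 1) (hh : ‖h‖ ≤ 1) : conj a * h - 1 ≠ 0 := by
  have := one_sub_conj_mul_ne_zero ha hh
  rw [← neg_ne_zero]
  simpa using this

theorem IsDiscAut.exists_formula {φ : OnePoint ℂ → OnePoint ℂ} (hφ : IsDiscAut φ) :
    ∃ e a : ℂ, conj e * e = 1 ∧ ‖a‖ < 1 ∧ ∀ ζ : ℂ,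
      φ ζ = if conj a * ζ - 1 = 0 then OnePoint.infty
        else ((e * (ζ - a) / (conj a * ζ - 1) : ℂ) : OnePoint ℂ) := by
  obtain ⟨A, t, a, ha, hA, hφ⟩ := hφ
  refine ⟨Complex.exp (t * Complex.I), a, ?_, ha, fun ζ ↦ ?_⟩
  · rw [← Complex.exp_conj, ← Complex.exp_add]
    simp
  · rw [hφ, OnePoint.smul_some_eq_ite, hA]
    simp [sub_eq_add_neg, mul_add]

/-- Disc automorphisms preserve the disc and the pseudo-hyperbolic distance. -/
theorem IsDiscAut.discGap_eq {φ : OnePoint ℂ → OnePoint ℂ} (hφ : IsDiscAut φ) {h h' ζ ζ' : ℂ}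
    (hh : ‖h‖ < 1) (e1 : φ h = h') (e2 : φ ζ = ζ') (hne : 1 - conj h * ζ ≠ 0) :
    discGap h' ζ' = discGap h ζ := by
  obtain ⟨e, a, he, ha, hf⟩ := hφ.exists_formula
  have h1 := conj_mul_sub_one_ne_zero ha hh.le
  rw [hf, if_neg h1] at e1
  rw [hf] at e2
  -- The point `ζ` may lie outside the disc, where the automorphism can have its pole. Finiteness of
  -- the image `ζ'` excludes this.
  split_ifs at e2 with h2
  · exact absurd e2.symm (OnePoint.coe_ne_infty _)
  have e1' := OnePoint.coe_injective e1
  have e2' := OnePoint.coe_injective e2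
  have n1 : ‖conj a * h - 1‖ ≠ 0 := norm_ne_zero_iff.2 h1
  have n2 : ‖conj a * ζ - 1‖ ≠ 0 := norm_ne_zero_iff.2 h2
  have n3 : ‖1 - conj h * ζ‖ ≠ 0 := norm_ne_zero_iff.2 hne
  have n4 : 1 - ‖a‖ ^ 2 ≠ 0 := by nlinarith [norm_nonneg a]
  have n5 : ‖1 - a * conj a‖ = 1 - ‖a‖ ^ 2 := by
    rcases one_sub_norm_sq_eq a with h | h
    · rw [h, mul_comm]
    · linarith
  rw [discGap, discGap, ← e1', ← e2', one_sub_norm_sq_discAut he h1, one_sub_norm_sq_discAut he h2,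
    one_sub_conj_mul_discAut he h1 h2, norm_div, norm_mul, norm_mul, n5, RCLike.norm_conj]
  field_simp

theorem IsDiscAut.norm_lt_one {φ : OnePoint ℂ → OnePoint ℂ} (hφ : IsDiscAut φ) {ζ : ℂ}
    (hζ : ‖ζ‖ < 1) : ∃ ζ' : ℂ, ‖ζ'‖ < 1 ∧ φ ζ = ζ' := by
  obtain ⟨e, a, he, ha, hf⟩ := hφ.exists_formula
  have h1 := conj_mul_sub_one_ne_zero ha hζ.le
  refine ⟨_, ?_, by rw [hf, if_neg h1]⟩
  have h2 := one_sub_norm_sq_discAut he h1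
  have h3 : 0 < ‖conj a * ζ - 1‖ := norm_pos_iff.2 h1
  have h4 : 0 < 1 - ‖a‖ ^ 2 := by nlinarith [norm_nonneg a]
  have h5 : 0 < 1 - ‖ζ‖ ^ 2 := by nlinarith [norm_nonneg ζ]
  have h6 : 0 < (1 - ‖a‖ ^ 2) * (1 - ‖ζ‖ ^ 2) / ‖conj a * ζ - 1‖ ^ 2 := by positivity
  rw [← h2] at h6
  by_contra h7
  nlinarith

/-! ### Coordinates and topology of `P` and `D` -/

namespace DiscBundle

variable {ι : Type*} {C : Type*} [TopologicalSpace C] [ChartedSpace ℂ C] [IsManifold 𝓘(ℂ) ω C]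
  (B : DiscBundle ι C)

theorem fibreCoord_trans {i j : ι} {p : B.P} (hi : B.proj p ∈ B.baseSet i)
    (hj : B.proj p ∈ B.baseSet j) :
    B.fibreCoord j p = B.trans i j (B.proj p) (B.fibreCoord i p) :=
  (B.trans_comp _ i j _ ⟨⟨B.mem_baseSet_at _, hi⟩, hj⟩ p.2).symm

theorem continuous_proj : Continuous B.proj := B.toCore.continuous_proj

theorem mem_D_iff {i : ι} {p : B.P} (hi : B.proj p ∈ B.baseSet i) :
    p ∈ B.D ↔ ∃ ζ : ℂ, ‖ζ‖ < 1 ∧ B.fibreCoord i p = ζ := by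
  constructor
  · rintro ⟨ζ, hζ, h⟩
    obtain ⟨ζ', h1, h2⟩ := (B.isDiscAut _ i _ ⟨B.mem_baseSet_at _, hi⟩).norm_lt_one hζ
    exact ⟨ζ', h1, by rw [B.fibreCoord_trans (B.mem_baseSet_at _) hi, h, h2]⟩
  · rintro ⟨ζ, hζ, h⟩
    obtain ⟨ζ', h1, h2⟩ := (B.isDiscAut i (B.indexAt (B.proj p)) _
      ⟨hi, B.mem_baseSet_at _⟩).norm_lt_one hζ
    exact ⟨ζ', h1, by rw [B.fibreCoord_trans hi (B.mem_baseSet_at _), h, h2]⟩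

/-- The point of `P` over `x` with given coordinate. -/
noncomputable def point (i : ι) (x : C) (w : OnePoint ℂ) : B.P :=
  (B.toCore.localTriv i).toOpenPartialHomeomorph.symm (x, w)

theorem fibreCoord_point {i : ι} {x : C} (hx : x ∈ B.baseSet i) (w : OnePoint ℂ) :
    B.fibreCoord i (B.point i x w) = w :=
  congrArg Prod.snd ((B.toCore.localTriv i).apply_symm_apply (x := (x, w))
    ((B.toCore.localTriv i).mem_target.2 hx))

theorem point_fibreCoord {i : ι} {p : B.P} (hp : B.proj p ∈ B.baseSet i) :
    B.point i (B.proj p) (B.fibreCoord i p) = p :=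
  (B.toCore.localTriv i).toOpenPartialHomeomorph.left_inv
    ((B.toCore.localTriv i).mem_source.2 hp)

theorem continuousOn_point (i : ι) :
    ContinuousOn (fun q : C × OnePoint ℂ ↦ B.point i q.1 q.2) (B.baseSet i ×ˢ univ) := by
  have h := (B.toCore.localTriv i).toOpenPartialHomeomorph.continuousOn_symm
  have ht : (B.toCore.localTriv i).target = B.baseSet i ×ˢ univ := rfl
  rw [ht] at h
  exact h

theorem continuousAt_fibreCoord {i : ι} {p : B.P} (hp : B.proj p ∈ B.baseSet i) :
    ContinuousAt (B.fibreCoord i) p :=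
  continuousAt_snd.comp ((B.toCore.localTriv i).toOpenPartialHomeomorph.continuousAt
    ((B.toCore.localTriv i).mem_source.2 hp))

theorem mem_chart_source_iff {i : ι} {e : OpenPartialHomeomorph C ℂ} {p : B.P} :
    p ∈ (B.chart i e false).source ↔
      B.proj p ∈ B.baseSet i ∧ B.proj p ∈ e.source ∧ B.fibreCoord i p ≠ OnePoint.infty := by
  rw [chart, OpenPartialHomeomorph.trans_source]
  have h0 : (sphereChart false).source = {OnePoint.infty}ᶜ := by
    ext w
    simp [sphereChart, affineChart, smulHomeo, sphereMatrix]
  refine and_congr ((B.toCore.localTriv i).mem_source) (and_congr Iff.rfl ?_)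
  rw [h0]
  exact Iff.rfl

theorem chart_apply (i : ι) (e : OpenPartialHomeomorph C ℂ) (p : B.P) :
    B.chart i e false p = (e (B.proj p), affineCoord (B.fibreCoord i p)) := by
  show (e (B.proj p), affineCoord ((1 : GL (Fin 2) ℂ) • B.fibreCoord i p)) = _
  rw [one_smul]

theorem chart_symm_apply (i : ι) (e : OpenPartialHomeomorph C ℂ) (q : ℂ × ℂ) :
    (B.chart i e false).symm q = B.point i (e.symm q.1) q.2 := by
  show B.point i (e.symm q.1) ((1 : GL (Fin 2) ℂ)⁻¹ • (q.2 : OnePoint ℂ)) = _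
  rw [inv_one, one_smul]

theorem mem_chart_target_iff {i : ι} {e : OpenPartialHomeomorph C ℂ} {q : ℂ × ℂ} :
    q ∈ (B.chart i e false).target ↔ q.1 ∈ e.target ∧ e.symm q.1 ∈ B.baseSet i := by
  constructor
  · intro hq
    have h1 := (B.chart i e false).map_target hq
    have h2 := (B.chart i e false).right_inv hq
    rw [B.mem_chart_source_iff, B.chart_symm_apply] at h1
    rw [B.chart_symm_apply, B.chart_apply] at h2
    refine ⟨?_, h1.1⟩
    have h3 := e.map_source h1.2.1
    have h4 : e (B.proj (B.point i (e.symm q.1) q.2)) = q.1 := congrArg Prod.fst h2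
    rwa [h4] at h3
  · rintro ⟨h1, h2⟩
    have h3 : B.point i (e.symm q.1) q.2 ∈ (B.chart i e false).source := by
      rw [B.mem_chart_source_iff]
      refine ⟨h2, e.map_target h1, ?_⟩
      rw [B.fibreCoord_point h2]
      exact OnePoint.coe_ne_infty _
    have h4 := (B.chart i e false).map_source h3
    rw [B.chart_apply, B.fibreCoord_point h2] at h4
    have h5 : e (B.proj (B.point i (e.symm q.1) q.2)) = q.1 := e.right_inv h1
    rw [h5] at h4
    exact h4

/-- Points of the closure of `D` have finite fibre coordinate. Their preferred charts are thus
affine, and Levi forms there are never computed in the chart at infinity. -/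
theorem chartAt_eq {p : B.P} (hp : B.fibreCoord (B.indexAt (B.proj p)) p ≠ OnePoint.infty) :
    chartAt (ℂ × ℂ) p = B.chart (B.indexAt (B.proj p)) (chartAt ℂ (B.proj p)) false := by
  classical
  show B.chart _ _ (decide _) = _
  congr 1
  simpa using hp

/-- Two points of one fibre are separated inside a common trivialization, other points by their
projections. -/
instance [T2Space C] : T2Space B.P := by
  refine ⟨fun p q hpq ↦ ?_⟩
  by_cases h : B.proj p = B.proj q
  · set T := (B.toCore.localTriv (B.indexAt (B.proj p))).toOpenPartialHomeomorph
    have hp : p ∈ T.source :=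
      (B.toCore.localTriv _).mem_source.2 (B.mem_baseSet_at (B.proj p))
    have hq : q ∈ T.source :=
      (B.toCore.localTriv _).mem_source.2 (h ▸ B.mem_baseSet_at (B.proj p))
    obtain ⟨u, v, hu, hv, hpu, hqv, huv⟩ := t2_separation (T.injOn.ne hp hq hpq)
    exact ⟨_, _, T.isOpen_inter_preimage hu, T.isOpen_inter_preimage hv, ⟨hp, hpu⟩, ⟨hq, hqv⟩,
      (huv.preimage T).mono inter_subset_right inter_subset_right⟩
  · exact separated_by_continuous B.continuous_proj h

/-- Finitely many compact subsets of trivializing sets cover `C`, and over each of them `P` is the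
image of a product with the compact sphere. -/
instance [T2Space C] [CompactSpace C] : CompactSpace B.P := by
  have hK : ∀ x : C, ∃ K ∈ 𝓝 x, IsCompact K ∧ K ⊆ B.baseSet (B.indexAt x) := fun x ↦ by
    obtain ⟨K, h1, h2, h3⟩ := local_compact_nhds
      ((B.isOpen_baseSet _).mem_nhds (B.mem_baseSet_at x))
    exact ⟨K, h1, h3, h2⟩
  choose K hK hKc hKs using hK
  obtain ⟨t, ht⟩ := isCompact_univ.elim_nhds_subcover K fun x _ ↦ hK x
  refine ⟨?_⟩
  have : (univ : Set B.P) = ⋃ x ∈ t, (fun q : C × OnePoint ℂ ↦ B.point (B.indexAt x) q.1 q.2) ''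
      (K x ×ˢ univ) := by
    refine (eq_univ_of_forall fun p ↦ ?_).symm
    obtain ⟨x, hx, hpx⟩ := mem_iUnion₂.1 (ht.2 (mem_univ (B.proj p)))
    exact mem_iUnion₂.2 ⟨x, hx, (B.proj p, B.fibreCoord (B.indexAt x) p), ⟨hpx, mem_univ _⟩,
      B.point_fibreCoord (hKs x hpx)⟩
  rw [this]
  exact t.isCompact_biUnion fun x _ ↦ ((hKc x).prod isCompact_univ).image_of_continuousOn
    ((B.continuousOn_point _).mono (prod_mono_left (hKs x)))

theorem isOpen_D : IsOpen B.D := by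
  rw [isOpen_iff_mem_nhds]
  intro p hp
  have hi := B.mem_baseSet_at (B.proj p)
  obtain ⟨ζ, hζ, h⟩ := hp
  have hU : IsOpen ((↑) '' Metric.ball (0 : ℂ) 1 : Set (OnePoint ℂ)) :=
    OnePoint.isOpenEmbedding_coe.isOpenMap _ Metric.isOpen_ball
  filter_upwards [(B.continuousAt_fibreCoord hi).eventually (hU.mem_nhds
    ⟨ζ, by simpa using hζ, h.symm⟩),
    B.continuous_proj.continuousAt.eventually ((B.isOpen_baseSet _).mem_nhds hi)] with q hq hq'
  obtain ⟨ξ, h1, h2⟩ := hq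
  exact (B.mem_D_iff hq').2 ⟨ξ, by simpa using h1, h2.symm⟩

theorem exists_norm_eq_one_of_mem_frontier {p : B.P} (hp : p ∈ frontier B.D) :
    ∃ ζ : ℂ, ‖ζ‖ = 1 ∧ B.fibreCoord (B.indexAt (B.proj p)) p = ζ := by
  have hi := B.mem_baseSet_at (B.proj p)
  rw [B.isOpen_D.frontier_eq] at hp
  have hK : IsClosed ((↑) '' Metric.closedBall (0 : ℂ) 1 : Set (OnePoint ℂ)) :=
    ((isCompact_closedBall (0 : ℂ) 1).image OnePoint.continuous_coe).isClosed
  have h1 : B.fibreCoord (B.indexAt (B.proj p)) p ∈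
      ((↑) '' Metric.closedBall (0 : ℂ) 1 : Set (OnePoint ℂ)) := by
    by_contra hn
    obtain ⟨q, ⟨h1, h2⟩, h3⟩ := mem_closure_iff_nhds.1 hp.1 _
      (((B.continuousAt_fibreCoord hi).eventually (hK.isOpen_compl.mem_nhds hn)).and
      (B.continuous_proj.continuousAt.eventually ((B.isOpen_baseSet _).mem_nhds hi)))
    obtain ⟨ζ, h4, h5⟩ := (B.mem_D_iff h2).1 h3
    exact h1 ⟨ζ, by simpa using h4.le, h5.symm⟩
  obtain ⟨ζ, h1, h2⟩ := h1
  rw [mem_closedBall_zero_iff] at h1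
  exact ⟨ζ, le_antisymm h1 (not_lt.1 fun h ↦ hp.2 ⟨ζ, h, h2.symm⟩), h2.symm⟩

end DiscBundle

/-! ### Real smoothness read in holomorphic charts -/

section RealCharts

variable {E : Type*} [NormedAddCommGroup E] [NormedSpace ℂ E]
  {X : Type*} [TopologicalSpace X] [ChartedSpace E X] [IsManifold 𝓘(ℂ, E) ω X]

theorem mem_maximalAtlas_real {φ : OpenPartialHomeomorph X E} (hφ : φ ∈ atlas E X) (n : ℕ∞ω) :
    φ ∈ IsManifold.maximalAtlas 𝓘(ℝ, E) n X := by
  have : IsManifold 𝓘(ℝ, E) n X := IsManifold.of_le (n := ω) le_top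
  exact IsManifold.subset_maximalAtlas hφ

theorem contMDiffAt_of_chart {φ : OpenPartialHomeomorph X E} (hφ : φ ∈ atlas E X) {n : ℕ∞ω}
    {f : X → ℝ} {p : X} (hp : p ∈ φ.source) (hf : ContDiffAt ℝ n (f ∘ φ.symm) (φ p)) :
    ContMDiffAt 𝓘(ℝ, E) 𝓘(ℝ, ℝ) n f p := by
  have h1 : ContMDiffAt 𝓘(ℝ, E) 𝓘(ℝ, E) n φ p :=
    contMDiffAt_of_mem_maximalAtlas (mem_maximalAtlas_real hφ n) hp
  refine (hf.contMDiffAt.comp p h1).congr_of_eventuallyEq ?_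
  filter_upwards [φ.open_source.mem_nhds hp] with q hq
  simp [φ.left_inv hq]

theorem ContMDiff.contDiffAt_chart {φ : OpenPartialHomeomorph X E} (hφ : φ ∈ atlas E X) {n : ℕ∞ω}
    {f : X → ℝ} (hf : ContMDiff 𝓘(ℝ, E) 𝓘(ℝ, ℝ) n f) {z : E} (hz : z ∈ φ.target) :
    ContDiffAt ℝ n (fun z ↦ f (φ.symm z)) z := by
  have h1 : ContMDiffAt 𝓘(ℝ, E) 𝓘(ℝ, E) n φ.symm z :=
    contMDiffAt_symm_of_mem_maximalAtlas (mem_maximalAtlas_real hφ n) hz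
  exact (hf.contMDiffAt.comp z h1).contDiffAt

end RealCharts

/-! ### The section and the defining function of `D` -/

namespace DiscBundle

variable {ι : Type*} {C : Type*} [TopologicalSpace C] [ChartedSpace ℂ C] [IsManifold 𝓘(ℂ) ω C]
  {B : DiscBundle ι C} {s : C → B.P}

theorem chart_mem_atlas (B : DiscBundle ι C) (i : ι) {e : OpenPartialHomeomorph C ℂ}
    (he : e ∈ atlas ℂ C) : B.chart i e false ∈ atlas (ℂ × ℂ) B.P :=
  ⟨i, e, he, false, rfl⟩

/-- The coordinate of a section over `baseSet i`. -/
noncomputable def sectionCoord (B : DiscBundle ι C) (s : C → B.P) (i : ι) (x : C) : ℂ :=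
  affineCoord (B.fibreCoord i (s x))

theorem IsSection.sectionCoord_spec (hs : B.IsSection s) {i : ι} {x : C} (hx : x ∈ B.baseSet i) :
    ‖B.sectionCoord s i x‖ < 1 ∧
      B.fibreCoord i (s x) = ((B.sectionCoord s i x : ℂ) : OnePoint ℂ) := by
  obtain ⟨ζ, h1, h2⟩ := (B.mem_D_iff (i := i) (by rwa [(hs x).1])).1 (hs x).2
  have h3 : B.sectionCoord s i x = ζ := by rw [sectionCoord, h2]; rfl
  rw [h3]
  exact ⟨h1, h2⟩

theorem IsHarmonicSection.continuous (hs : B.IsHarmonicSection s) : Continuous s := by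
  rw [continuous_iff_continuousAt]
  intro x
  set i := B.indexAt x
  set e := chartAt ℂ x with he
  have hx : x ∈ B.baseSet i := B.mem_baseSet_at x
  have hex : x ∈ e.source := mem_chart_source ℂ x
  have hxe : e x ∈ e.target ∩ e.symm ⁻¹' B.baseSet i :=
    ⟨e.map_source hex, by rwa [mem_preimage, e.left_inv hex]⟩
  have hopen : IsOpen (e.target ∩ e.symm ⁻¹' B.baseSet i) :=
    e.isOpen_inter_preimage_symm (B.isOpen_baseSet i)
  have h1 : ContinuousAt (B.localRep s i e) (e x) :=
    ((hs.2 i e (_root_.chart_mem_atlas ℂ x)).1.continuousOn.continuousAt (hopen.mem_nhds hxe))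
  have h2 : ContinuousAt (fun y ↦ (y, ((B.localRep s i e (e y) : ℂ) : OnePoint ℂ))) x :=
    continuousAt_id.prodMk (OnePoint.continuous_coe.continuousAt.comp
      (ContinuousAt.comp (f := e) h1 (e.continuousAt hex)))
  have h3 : ContinuousAt (fun q : C × OnePoint ℂ ↦ B.point i q.1 q.2)
      (x, ((B.localRep s i e (e x) : ℂ) : OnePoint ℂ)) :=
    (B.continuousOn_point i).continuousAt (((B.isOpen_baseSet i).prod isOpen_univ).mem_nhds
      ⟨hx, mem_univ _⟩)
  refine (ContinuousAt.comp (f := fun y ↦ (y, ((B.localRep s i e (e y) : ℂ) : OnePoint ℂ)))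
    h3 h2).congr ?_
  filter_upwards [e.open_source.mem_nhds hex, (B.isOpen_baseSet i).mem_nhds hx] with y hy hyi
  have h4 : B.localRep s i e (e y) = B.sectionCoord s i y := by
    rw [localRep, e.left_inv hy]; rfl
  show B.point i y ((B.localRep s i e (e y) : ℂ) : OnePoint ℂ) = s y
  rw [h4, ← (hs.1.sectionCoord_spec hyi).2]
  have h5 := B.point_fibreCoord (i := i) (p := s y) (by rwa [(hs.1 y).1])
  rwa [(hs.1 y).1] at h5

/-- Every point of `D` lies in a fibre disc, which is connected and meets the connected set `s(C)`.
-/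
theorem isConnected_D [ConnectedSpace C] (hs : B.IsHarmonicSection s) : IsConnected B.D := by
  obtain ⟨x₀⟩ : Nonempty C := inferInstance
  refine ⟨⟨s x₀, (hs.1 x₀).2⟩, isPreconnected_of_forall (s x₀) fun p hp ↦ ?_⟩
  have hi := B.mem_baseSet_at (B.proj p)
  set F : Set B.P := (fun ζ : ℂ ↦ B.point (B.indexAt (B.proj p)) (B.proj p) ζ) '' Metric.ball 0 1
  have hF : IsPreconnected F := by
    refine (convex_ball (0 : ℂ) 1).isPreconnected.image _ ?_
    refine (B.continuousOn_point _).comp (f := fun ζ : ℂ ↦ (B.proj p, (ζ : OnePoint ℂ)))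
      (continuousOn_const.prodMk OnePoint.continuous_coe.continuousOn) (fun ζ _ ↦ ⟨hi, mem_univ _⟩)
  have hsF : s (B.proj p) ∈ F := by
    obtain ⟨h1, h2⟩ := hs.1.sectionCoord_spec hi
    refine ⟨_, by simpa using h1, ?_⟩
    show B.point _ _ _ = _
    rw [← h2]
    have h5 := B.point_fibreCoord (i := B.indexAt (B.proj p)) (p := s (B.proj p))
      (by rw [(hs.1 _).1]; exact hi)
    rwa [(hs.1 _).1] at h5
  have hpF : p ∈ F := by
    obtain ⟨ζ, h1, h2⟩ := hp
    refine ⟨ζ, by simpa using h1, ?_⟩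
    show B.point _ _ _ = _
    rw [← h2, B.point_fibreCoord hi]
  have hFD : F ⊆ B.D := by
    rintro _ ⟨ζ, h1, rfl⟩
    exact (B.mem_D_iff (i := B.indexAt (B.proj p))
      (p := B.point (B.indexAt (B.proj p)) (B.proj p) ζ) hi).2
      ⟨ζ, by simpa using h1, B.fibreCoord_point hi _⟩
  refine ⟨range s ∪ F, union_subset (range_subset_iff.2 fun x ↦ (hs.1 x).2) hFD,
    Or.inl ⟨x₀, rfl⟩, Or.inr hpF, ?_⟩
  exact (isPreconnected_range hs.continuous).union _ ⟨B.proj p, rfl⟩ hsF hF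

/-- `ζ` is the coordinate of `p` over `baseSet i`, and `p` does not lie on the reflection of the
section in the boundary of `D`. -/
def IsRegularCoord (B : DiscBundle ι C) (s : C → B.P) (i : ι) (ζ : ℂ) (p : B.P) : Prop :=
  B.proj p ∈ B.baseSet i ∧ B.fibreCoord i p = ζ ∧
    1 - conj (B.sectionCoord s i (B.proj p)) * ζ ≠ 0

open Classical in
/-- `1` minus the squared pseudo-hyperbolic distance to the section in the fibres. -/
noncomputable def sectionGap (B : DiscBundle ι C) (s : C → B.P) (p : B.P) : ℝ :=
  if h : ∃ q : ι × ℂ, B.IsRegularCoord s q.1 q.2 p then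
    discGap (B.sectionCoord s h.choose.1 (B.proj p)) h.choose.2
  else 0

/-- Independence of the chosen coordinate: two coordinates of `p` differ by a disc automorphism that
also relates the coordinates of the section, so `IsDiscAut.discGap_eq` applies. -/
theorem IsSection.sectionGap_eq (hs : B.IsSection s) {i : ι} {ζ : ℂ} {p : B.P}
    (h : B.IsRegularCoord s i ζ p) :
    B.sectionGap s p = discGap (B.sectionCoord s i (B.proj p)) ζ := by
  have hex : ∃ q : ι × ℂ, B.IsRegularCoord s q.1 q.2 p := ⟨(i, ζ), h⟩
  rw [sectionGap, dif_pos hex]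
  obtain ⟨h1, h2, -⟩ := hex.choose_spec
  obtain ⟨k1, k2, k3⟩ := h
  refine (B.isDiscAut i hex.choose.1 _ ⟨k1, h1⟩).discGap_eq
    (hs.sectionCoord_spec k1).1 ?_ ?_ k3
  · rw [← (hs.sectionCoord_spec k1).2, ← (hs.sectionCoord_spec h1).2]
    have hp := (hs (B.proj p)).1
    have := B.fibreCoord_trans (i := i) (j := hex.choose.1) (p := s (B.proj p))
      (by rwa [hp]) (by rwa [hp])
    rw [this, hp]
  · rw [← k2, ← h2, B.fibreCoord_trans k1 h1]

theorem isRegularCoord_chart_symm {i : ι}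
    {e : OpenPartialHomeomorph C ℂ} {q : ℂ × ℂ} (hq : q ∈ (B.chart i e false).target)
    (hne : 1 - conj (B.localRep s i e q.1) * q.2 ≠ 0) :
    B.IsRegularCoord s i q.2 ((B.chart i e false).symm q) := by
  rw [B.mem_chart_target_iff] at hq
  rw [B.chart_symm_apply]
  exact ⟨hq.2, B.fibreCoord_point hq.2 _, hne⟩

theorem IsSection.sectionGap_chart_symm (hs : B.IsSection s) {i : ι}
    {e : OpenPartialHomeomorph C ℂ} {q : ℂ × ℂ} (hq : q ∈ (B.chart i e false).target)
    (hne : 1 - conj (B.localRep s i e q.1) * q.2 ≠ 0) :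
    B.sectionGap s ((B.chart i e false).symm q) = discGap (B.localRep s i e q.1) q.2 := by
  rw [hs.sectionGap_eq (isRegularCoord_chart_symm hq hne), B.chart_symm_apply]
  rfl

/-- The domain of `sectionGap`. -/
def regularSet (B : DiscBundle ι C) (s : C → B.P) : Set B.P :=
  {p | ∃ i ζ, B.IsRegularCoord s i ζ p}

theorem IsHarmonicSection.contDiffAt_localRep (hs : B.IsHarmonicSection s) {i : ι}
    {e : OpenPartialHomeomorph C ℂ} (he : e ∈ atlas ℂ C) {z : ℂ}
    (hz : z ∈ e.target ∩ e.symm ⁻¹' B.baseSet i) : ContDiffAt ℝ 2 (B.localRep s i e) z :=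
  (hs.2 i e he).1.contDiffAt
    ((e.isOpen_inter_preimage_symm (B.isOpen_baseSet i)).mem_nhds hz)

/-- A chart at a regular point in which the point has regular coordinates. -/
theorem IsRegularCoord.mem_chart {i : ι} {ζ : ℂ} {p : B.P} (h : B.IsRegularCoord s i ζ p) :
    p ∈ (B.chart i (chartAt ℂ (B.proj p)) false).source ∧
      B.chart i (chartAt ℂ (B.proj p)) false p = (chartAt ℂ (B.proj p) (B.proj p), ζ) ∧
      1 - conj (B.localRep s i (chartAt ℂ (B.proj p)) (chartAt ℂ (B.proj p) (B.proj p))) * ζ ≠ 0 := by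
  refine ⟨?_, ?_, ?_⟩
  · rw [B.mem_chart_source_iff, h.2.1]
    exact ⟨h.1, mem_chart_source ℂ _, OnePoint.coe_ne_infty _⟩
  · rw [B.chart_apply, h.2.1]; rfl
  · rw [localRep, (chartAt ℂ (B.proj p)).left_inv (mem_chart_source ℂ _)]
    exact h.2.2

/-- Regularity of the coordinates is an open condition, in a chart. -/
theorem IsHarmonicSection.eventually_regular (hs : B.IsHarmonicSection s) {i : ι}
    {e : OpenPartialHomeomorph C ℂ} (he : e ∈ atlas ℂ C) {q : ℂ × ℂ}
    (hq : q ∈ (B.chart i e false).target) (hne : 1 - conj (B.localRep s i e q.1) * q.2 ≠ 0) :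
    ∀ᶠ q' in 𝓝 q, q' ∈ (B.chart i e false).target ∧
      1 - conj (B.localRep s i e q'.1) * q'.2 ≠ 0 := by
  have h1 : ContinuousAt (fun q' : ℂ × ℂ ↦ B.localRep s i e q'.1) q :=
    ContinuousAt.comp (g := B.localRep s i e) (f := Prod.fst)
      (hs.contDiffAt_localRep he ((B.mem_chart_target_iff).1 hq)).continuousAt continuousAt_fst
  have h2 : ContinuousAt (fun q' : ℂ × ℂ ↦ 1 - conj (B.localRep s i e q'.1) * q'.2) q :=
    continuousAt_const.sub ((Complex.continuous_conj.continuousAt.comp h1).mul continuousAt_snd)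
  exact ((B.chart i e false).open_target.eventually_mem hq).and (h2.eventually_ne hne)

theorem IsHarmonicSection.isOpen_regularSet (hs : B.IsHarmonicSection s) :
    IsOpen (B.regularSet s) := by
  rw [isOpen_iff_mem_nhds]
  rintro p ⟨i, ζ, h⟩
  obtain ⟨h1, h2, h3⟩ := h.mem_chart
  set e := chartAt ℂ (B.proj p)
  have hq : (B.chart i e false) p ∈ (B.chart i e false).target := (B.chart i e false).map_source h1
  have h4 := hs.eventually_regular (_root_.chart_mem_atlas ℂ (B.proj p)) hq (by rw [h2]; exact h3)
  filter_upwards [((B.chart i e false).continuousAt h1).eventually h4,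
    (B.chart i e false).open_source.mem_nhds h1] with p' hp' hps
  have h5 := isRegularCoord_chart_symm hp'.1 hp'.2
  rw [(B.chart i e false).left_inv hps] at h5
  exact ⟨_, _, h5⟩

theorem IsSection.isRegularCoord_of_norm_le (hs : B.IsSection s) {i : ι} {ζ : ℂ} {p : B.P}
    (hp : B.proj p ∈ B.baseSet i) (h : B.fibreCoord i p = ζ) (hζ : ‖ζ‖ ≤ 1) :
    B.IsRegularCoord s i ζ p :=
  ⟨hp, h, one_sub_conj_mul_ne_zero (hs.sectionCoord_spec hp).1 hζ⟩

/-- The defining function of `D` with weight `f`. -/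
noncomputable def definingFunction (B : DiscBundle ι C) (s : C → B.P) (f : C → ℝ) (p : B.P) : ℝ :=
  -(Real.exp (-f (B.proj p)) * B.sectionGap s p)

theorem IsHarmonicSection.definingFunction_chart_symm (hs : B.IsHarmonicSection s) {f : C → ℝ}
    {i : ι} {e : OpenPartialHomeomorph C ℂ} (he : e ∈ atlas ℂ C) {q : ℂ × ℂ}
    (hq : q ∈ (B.chart i e false).target) (hne : 1 - conj (B.localRep s i e q.1) * q.2 ≠ 0) :
    B.definingFunction s f ∘ (B.chart i e false).symm =ᶠ[𝓝 q] fun q ↦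
      -(Real.exp (-f (e.symm q.1)) * discGap (B.localRep s i e q.1) q.2) := by
  filter_upwards [hs.eventually_regular he hq hne] with q' hq'
  simp only [Function.comp, definingFunction]
  rw [hs.1.sectionGap_chart_symm hq'.1 hq'.2, B.chart_symm_apply]
  rfl

theorem IsHarmonicSection.contMDiffAt_definingFunction (hs : B.IsHarmonicSection s) {f : C → ℝ}
    (hf : ContMDiff 𝓘(ℝ, ℂ) 𝓘(ℝ, ℝ) 2 f) {p : B.P} (hp : p ∈ B.regularSet s) :
    ContMDiffAt 𝓘(ℝ, ℂ × ℂ) 𝓘(ℝ, ℝ) 2 (B.definingFunction s f) p := by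
  obtain ⟨i, ζ, h⟩ := hp
  obtain ⟨h1, h2, h3⟩ := h.mem_chart
  set e := chartAt ℂ (B.proj p)
  have hat : e ∈ atlas ℂ C := _root_.chart_mem_atlas ℂ _
  have hq : (B.chart i e false) p ∈ (B.chart i e false).target := (B.chart i e false).map_source h1
  refine contMDiffAt_of_chart (φ := B.chart i e false) (B.chart_mem_atlas i hat) h1 ?_
  rw [h2] at hq ⊢
  refine ContDiffAt.congr_of_eventuallyEq ?_ (hs.definingFunction_chart_symm hat hq h3)
  have hz := B.mem_chart_target_iff.1 hq
  have a1 : ContDiffAt ℝ 2 (fun q : ℂ × ℂ ↦ f (e.symm q.1)) (e (B.proj p), ζ) :=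
    ContDiffAt.comp (g := fun z ↦ f (e.symm z)) (f := Prod.fst) _
      (hf.contDiffAt_chart hat hz.1) contDiffAt_fst
  have a2 : ContDiffAt ℝ 2 (fun q : ℂ × ℂ ↦ B.localRep s i e q.1) (e (B.proj p), ζ) :=
    ContDiffAt.comp (g := B.localRep s i e) (f := Prod.fst) _
      (hs.contDiffAt_localRep hat hz) contDiffAt_fst
  exact (a1.neg.exp.mul (contDiffAt_discGap a2 contDiffAt_snd h3)).neg

/-- All factors of `r` other than `1 - |ζ|²` have constant sign on the whole regular set, so `r` has
the sign of `|ζ|² - 1` even beyond the closure of `D`. -/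
theorem IsSection.mem_D_iff_definingFunction_neg (hs : B.IsSection s) (f : C → ℝ) {p : B.P}
    (hp : p ∈ B.regularSet s) : p ∈ B.D ↔ B.definingFunction s f p < 0 := by
  obtain ⟨i, ζ, h⟩ := hp
  have h1 := (hs.sectionCoord_spec h.1).1
  have h3 : 0 < 1 - ‖B.sectionCoord s i (B.proj p)‖ ^ 2 := by
    nlinarith [norm_nonneg (B.sectionCoord s i (B.proj p))]
  have h4 : 0 < ‖1 - conj (B.sectionCoord s i (B.proj p)) * ζ‖ := norm_pos_iff.2 h.2.2
  have h2 : B.definingFunction s f p < 0 ↔ ‖ζ‖ < 1 := by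
    rw [definingFunction, neg_lt_zero, mul_pos_iff_of_pos_left (Real.exp_pos _),
      hs.sectionGap_eq h, discGap, div_pos_iff_of_pos_right (by positivity),
      mul_pos_iff_of_pos_left h3, sub_pos, sq_lt_one_iff₀ (norm_nonneg _)]
  rw [h2, B.mem_D_iff h.1]
  constructor
  · rintro ⟨ξ, h5, h6⟩
    rw [h.2.1] at h6
    rwa [OnePoint.coe_injective h6]
  · exact fun h5 ↦ ⟨ζ, h5, h.2.1⟩

theorem IsHarmonicSection.isDefiningFunction (hs : B.IsHarmonicSection s) {f : C → ℝ}
    (hf : ContMDiff 𝓘(ℝ, ℂ) 𝓘(ℝ, ℝ) 2 f) :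
    IsDefiningFunction (ℂ × ℂ) B.D (B.definingFunction s f) := by
  have hD : B.D ⊆ B.regularSet s := by
    rintro p ⟨ζ, h1, h2⟩
    exact ⟨_, ζ, hs.1.isRegularCoord_of_norm_le (B.mem_baseSet_at _) h2 h1.le⟩
  refine ⟨B.regularSet s, hs.isOpen_regularSet, ?_, fun p hp ↦
    (hs.contMDiffAt_definingFunction hf hp).contMDiffWithinAt, ?_, fun p hp ↦ ?_⟩
  · rw [closure_eq_self_union_frontier]
    refine union_subset hD fun p hp ↦ ?_
    obtain ⟨ζ, h1, h2⟩ := B.exists_norm_eq_one_of_mem_frontier hp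
    exact ⟨_, ζ, hs.1.isRegularCoord_of_norm_le (B.mem_baseSet_at _) h2 h1.le⟩
  · ext p
    exact ⟨fun h ↦ ⟨hD h, (hs.1.mem_D_iff_definingFunction_neg f (hD h)).1 h⟩,
      fun h ↦ (hs.1.mem_D_iff_definingFunction_neg f h.1).2 h.2⟩
  · obtain ⟨ζ, h1, h2⟩ := B.exists_norm_eq_one_of_mem_frontier hp
    have hreg := hs.1.isRegularCoord_of_norm_le (B.mem_baseSet_at _) h2 h1.le
    obtain ⟨k1, k2, k3⟩ := hreg.mem_chart
    have hsm := hs.contMDiffAt_definingFunction hf ⟨_, _, hreg⟩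
    have hmd := hsm.mdifferentiableAt (by simp)
    have hch := B.chartAt_eq (p := p) (by rw [h2]; exact OnePoint.coe_ne_infty _)
    intro h0
    rw [hmd.mfderiv] at h0
    simp only [writtenInExtChartAt, extChartAt, OpenPartialHomeomorph.extend,
      modelWithCornersSelf_partialEquiv, PartialEquiv.trans_refl, modelWithCornersSelf_coe, range_id,
      fderivWithin_univ, hch] at h0
    set i := B.indexAt (B.proj p)
    set e := chartAt ℂ (B.proj p)
    have hat : e ∈ atlas ℂ C := _root_.chart_mem_atlas ℂ _
    have hq : (B.chart i e false) p ∈ (B.chart i e false).target :=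
      (B.chart i e false).map_source k1
    rw [k2] at hq
    have hz := B.mem_chart_target_iff.1 hq
    have hfd : fderiv ℝ (B.definingFunction s f ∘ (B.chart i e false).symm)
        (e (B.proj p), ζ) = 0 := by
      rw [← k2]
      exact h0
    rw [(hs.definingFunction_chart_symm hat hq k3).fderiv_eq] at hfd
    set h := B.localRep s i e with hh
    -- In coordinates `r = -(1 - |ζ|²) k` with `k > 0` at the boundary point. The first factor
    -- vanishes there, so `dr` is `-k` times the differential of `1 - |ζ|²`.
    let k : ℂ × ℂ → ℝ := fun q ↦ Real.exp (-f (e.symm q.1)) * (1 - ‖h q.1‖ ^ 2) /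
      ‖1 - conj (h q.1) * q.2‖ ^ 2
    have hk : DifferentiableAt ℝ k (e (B.proj p), ζ) := by
      have a1 : ContDiffAt ℝ 2 (fun q : ℂ × ℂ ↦ f (e.symm q.1)) (e (B.proj p), ζ) :=
        ContDiffAt.comp (g := fun z ↦ f (e.symm z)) (f := Prod.fst) _
          (hf.contDiffAt_chart hat hz.1) contDiffAt_fst
      have a2 : ContDiffAt ℝ 2 (fun q : ℂ × ℂ ↦ h q.1) (e (B.proj p), ζ) :=
        ContDiffAt.comp (g := h) (f := Prod.fst) _ (hs.contDiffAt_localRep hat hz) contDiffAt_fst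
      have a3 : ContDiffAt ℝ 2 (fun q : ℂ × ℂ ↦ conj (h q.1)) (e (B.proj p), ζ) :=
        Complex.conjCLE.contDiff.contDiffAt.comp _ a2
      have a4 : ContDiffAt ℝ 2 (fun q : ℂ × ℂ ↦ ‖1 - conj (h q.1) * q.2‖ ^ 2) (e (B.proj p), ζ) :=
        (contDiffAt_const.sub (a3.mul contDiffAt_snd)).norm_sq ℝ
      exact ((a1.neg.exp.mul (contDiffAt_const.sub (a2.norm_sq ℝ))).div a4
        (by simpa using k3)).differentiableAt (by simp)
    have hu : HasFDerivAt (fun q : ℂ × ℂ ↦ 1 - ‖q.2‖ ^ 2) _ (e (B.proj p), ζ) :=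
      (hasFDerivAt_snd (𝕜 := ℝ) (p := (e (B.proj p), ζ))).norm_sq.const_sub 1
    have hprod := (hu.mul hk.hasFDerivAt).neg
    have heq : (fun q : ℂ × ℂ ↦ -(Real.exp (-f (e.symm q.1)) * discGap (h q.1) q.2)) =
        -((fun q : ℂ × ℂ ↦ 1 - ‖q.2‖ ^ 2) * k) := by
      funext q
      simp only [Pi.neg_apply, Pi.mul_apply, discGap, k]
      ring
    rw [heq, hprod.fderiv] at hfd
    -- In the radial direction of the fibre the derivative of `r` is `2k`, since `|ζ| = 1`.
    have h5 := DFunLike.congr_fun hfd ((0, ζ) : ℂ × ℂ)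
    simp [h1] at h5
    have h6 : ‖h (e (B.proj p))‖ < 1 := (hs.1.sectionCoord_spec hz.2).1
    have h7 : 0 < 1 - ‖h (e (B.proj p))‖ ^ 2 := by nlinarith [norm_nonneg (h (e (B.proj p)))]
    have h8 : 0 < ‖1 - conj (h (e (B.proj p))) * ζ‖ := norm_pos_iff.2 k3
    have h9 : 0 < k (e (B.proj p), ζ) := by
      have := Real.exp_pos (-f (e.symm (e (B.proj p))))
      simp only [k]
      positivity
    exact h9.ne' h5

end DiscBundle

/-! ### Local strict positivity near the boundary -/

theorem prod_norm_sq_le (v : ℂ × ℂ) : ‖v‖ ^ 2 ≤ ‖v.1‖ ^ 2 + ‖v.2‖ ^ 2 := by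
  rw [Prod.norm_def]
  rcases max_cases ‖v.1‖ ‖v.2‖ with ⟨h, -⟩ | ⟨h, -⟩ <;> rw [h] <;>
    nlinarith [sq_nonneg ‖v.1‖, sq_nonneg ‖v.2‖]

theorem wirtinger_wirtingerBar_norm_sq_sub (z₀ z : ℂ) :
    wirtinger (wirtingerBar fun u ↦ ((‖u - z₀‖ ^ 2 : ℝ) : ℂ)) z = 1 := by
  have h1 := (HasWirtinger.id z).sub (HasWirtinger.const z₀ z)
  have h2 := (h1.mul h1.conj_comp).mixed
  have h3 : (fun u : ℂ ↦ ((‖u - z₀‖ ^ 2 : ℝ) : ℂ)) = fun u ↦ (u - z₀) * conj (u - z₀) := by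
    funext u
    rw [Complex.mul_conj, Complex.normSq_eq_norm_sq]
  rw [h3, h2]
  simp

theorem continuousAt_discGap {f g : ℂ × ℂ → ℂ} {q : ℂ × ℂ} (hf : ContinuousAt f q)
    (hg : ContinuousAt g q) (hne : 1 - conj (f q) * g q ≠ 0) :
    ContinuousAt (fun y ↦ discGap (f y) (g y)) q := by
  have hc : ContinuousAt (fun y ↦ conj (f y)) q := Complex.continuous_conj.continuousAt.comp hf
  exact ((continuousAt_const.sub (hf.norm.pow 2)).mul (continuousAt_const.sub (hg.norm.pow 2))).div
    ((continuousAt_const.sub (hc.mul hg)).norm.pow 2) (by simpa using hne)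

/-- Strict plurisubharmonicity of the weighted potential near a boundary point. -/
theorem exists_flatLevi_bound {h : ℂ → ℂ} {ψ : ℂ → ℝ} {Ω : Set ℂ} (hΩ : IsOpen Ω)
    (hh : ∀ z ∈ Ω, ContDiffAt ℝ 2 h z)
    (harm : ∀ z ∈ Ω, wirtinger (wirtingerBar h) z + 2 * conj (h z) / (1 - (‖h z‖ : ℂ) ^ 2) *
      wirtinger h z * wirtingerBar h z = 0)
    (hn : ∀ z ∈ Ω, ‖h z‖ < 1) (hψ : ∀ z ∈ Ω, ContDiffAt ℝ ∞ ψ z) {z₀ ζ₀ : ℂ} (hz₀ : z₀ ∈ Ω)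
    (hζ₀ : ‖ζ₀‖ = 1)
    (hcase : Function.Surjective (fderiv ℝ h z₀) ∨ ψ =ᶠ[𝓝 z₀] fun z ↦ ‖z - z₀‖ ^ 2) :
    ∃ ε₀ > 0, ∃ W ∈ 𝓝 (z₀, ζ₀), ∀ ε, 0 < ε → ε < ε₀ → ∃ c > 0, ∀ q ∈ W, ‖q.2‖ < 1 →
      ∀ v, c * ‖v‖ ^ 2 ≤
        flatLevi (fun q : ℂ × ℂ ↦ ε * ψ q.1 - Real.log (discGap (h q.1) q.2)) q v v := by
  have hΩ' : ∀ᶠ q : ℂ × ℂ in 𝓝 (z₀, ζ₀), q.1 ∈ Ω :=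
    continuousAt_fst.eventually (hΩ.mem_nhds hz₀)
  have hgap : ContinuousAt (fun q : ℂ × ℂ ↦ discGap (h q.1) q.2) (z₀, ζ₀) :=
    continuousAt_discGap (ContinuousAt.comp (g := h) (f := Prod.fst) (hh z₀ hz₀).continuousAt
      continuousAt_fst) continuousAt_snd (one_sub_conj_mul_ne_zero (hn z₀ hz₀) hζ₀.le)
  have hgap0 : discGap (h z₀) ζ₀ = 0 := by simp [discGap, hζ₀]
  set κ : ℂ × ℂ → ℝ := fun q ↦
    leviCoeff (wirtinger h q.1) (wirtingerBar h q.1) (1 - discGap (h q.1) q.2) with hκ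
  set Q : ℂ × ℂ → ℝ := fun q ↦ (wirtinger (wirtingerBar fun u ↦ (ψ u : ℂ)) q.1).re with hQ
  -- Both cases reduce to bounding the `|v₁|²` coefficient `κ + εQ` below; the cap `1/2` on `c`
  -- comes from the coefficient of `|v₂|²`.
  have key : ∀ ε q c, q.1 ∈ Ω → ‖q.2‖ < 1 → 0 ≤ κ q → c ≤ κ q + ε * Q q → c ≤ 1 / 2 → 0 ≤ c →
      ∀ v, c * ‖v‖ ^ 2 ≤
        flatLevi (fun q : ℂ × ℂ ↦ ε * ψ q.1 - Real.log (discGap (h q.1) q.2)) q v v := by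
    intro ε q c h1 h2 h3 h4 h5 h6 v
    have h7 := flatLevi_discPotential_ge (ε := ε) (hh _ h1) (harm _ h1)
      ((hψ _ h1).of_le (WithTop.coe_le_coe.2 (le_top : (2 : ℕ∞) ≤ ⊤))) (hn _ h1) h2 h3 v
    refine le_trans ?_ h7
    calc c * ‖v‖ ^ 2 ≤ c * (‖v.1‖ ^ 2 + ‖v.2‖ ^ 2) := by gcongr; exact prod_norm_sq_le v
      _ = c * ‖v.1‖ ^ 2 + c * ‖v.2‖ ^ 2 := by ring
      _ ≤ (κ q + ε * Q q) * ‖v.1‖ ^ 2 + 1 / 2 * ‖v.2‖ ^ 2 := by gcongr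
      _ = _ := by simp only [hκ, hQ]; ring
  rcases hcase with hs | hloc
  · have ca : ContinuousAt (fun q : ℂ × ℂ ↦ wirtinger h q.1) (z₀, ζ₀) :=
      ContinuousAt.comp (g := wirtinger h) (f := Prod.fst)
        (differentiableAt_wirtinger (hh z₀ hz₀)).continuousAt continuousAt_fst
    have cb : ContinuousAt (fun q : ℂ × ℂ ↦ wirtingerBar h q.1) (z₀, ζ₀) :=
      ContinuousAt.comp (g := wirtingerBar h) (f := Prod.fst)
        (differentiableAt_wirtingerBar (hh z₀ hz₀)).continuousAt continuousAt_fst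
    have cκ : ContinuousAt κ (z₀, ζ₀) := by
      simp only [hκ, leviCoeff]
      fun_prop
    have κ0 : 0 < κ (z₀, ζ₀) := by
      have h1 := norm_wirtinger_ne_norm_wirtingerBar hs
      have h2 : κ (z₀, ζ₀) = (‖wirtinger h z₀‖ - ‖wirtingerBar h z₀‖) ^ 2 := by
        simp only [hκ, leviCoeff, hgap0]; ring
      rw [h2]
      have := sub_ne_zero.2 h1
      positivity
    -- A third derivative of `ψ` is used, to obtain continuity of the second-order quantity `Q`.
    have cQ : ContinuousAt Q (z₀, ζ₀) := by
      have h1 : ContDiffAt ℝ 3 (fun u ↦ (ψ u : ℂ)) z₀ :=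
        Complex.ofRealCLM.contDiff.contDiffAt.comp z₀
          ((hψ z₀ hz₀).of_le (WithTop.coe_le_coe.2 (le_top : (3 : ℕ∞) ≤ ⊤)))
      have h2 : ContDiffAt ℝ 2 (fderiv ℝ fun u ↦ (ψ u : ℂ)) z₀ :=
        h1.fderiv_right (m := 2) (by norm_num)
      have h3 : ContDiffAt ℝ 2 (wirtingerBar fun u ↦ (ψ u : ℂ)) z₀ := by
        unfold wirtingerBar
        exact ((h2.clm_apply contDiffAt_const).add
          (contDiffAt_const.mul (h2.clm_apply contDiffAt_const))).div_const 2
      exact Complex.continuous_re.continuousAt.comp (ContinuousAt.comp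
        (g := wirtinger (wirtingerBar fun u ↦ (ψ u : ℂ))) (f := Prod.fst)
        (differentiableAt_wirtinger h3).continuousAt continuousAt_fst)
    set M := |Q (z₀, ζ₀)| + 1 with hM
    have M0 : 0 < M := by positivity
    have hMev : ∀ᶠ q in 𝓝 (z₀, ζ₀), |Q q| < M :=
      cQ.abs.eventually (gt_mem_nhds (lt_add_one _))
    -- On this neighbourhood `κ > κ₀ / 2`, where `κ₀ = κ (z₀, ζ₀)`, and `ε|Q| ≤ κ₀ / 4` for `ε < κ₀
    -- / (4M)`, so `κ₀ / 4` remains. The neighbourhood does not depend on `ε`, which allows a finite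
    -- cover to be extracted before `ε` is fixed.
    refine ⟨κ (z₀, ζ₀) / (4 * M), by positivity, _,
      (hΩ'.and (hMev.and (cκ.eventually (lt_mem_nhds (half_lt_self κ0))))), fun ε hε hε' ↦
      ⟨min (κ (z₀, ζ₀) / 4) (1 / 2), by positivity, ?_⟩⟩
    rintro q ⟨h1, h2, h3⟩ h4
    refine key ε q _ h1 h4 (by linarith) ((min_le_left _ _).trans ?_) (min_le_right _ _)
      (by positivity)
    have h5 : ε * |Q q| ≤ κ (z₀, ζ₀) / 4 := by
      calc ε * |Q q| ≤ κ (z₀, ζ₀) / (4 * M) * M := by gcongr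
        _ = κ (z₀, ζ₀) / 4 := by field_simp
    have h6 : -(ε * |Q q|) ≤ ε * Q q := by
      rw [← mul_neg]
      gcongr
      exact neg_abs_le _
    linarith
  · have hQ1 : ∀ᶠ q in 𝓝 (z₀, ζ₀), Q q = 1 := by
      have h1 : ∀ᶠ q : ℂ × ℂ in 𝓝 (z₀, ζ₀), ψ =ᶠ[𝓝 q.1] fun z ↦ ‖z - z₀‖ ^ 2 :=
        (continuousAt_fst (p := (z₀, ζ₀))).eventually (eventually_eventually_nhds.2 hloc)
      filter_upwards [h1] with q hq
      have h2 : (fun u ↦ (ψ u : ℂ)) =ᶠ[𝓝 q.1] fun u ↦ ((‖u - z₀‖ ^ 2 : ℝ) : ℂ) := by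
        filter_upwards [hq] with u hu
        rw [hu]
      simp only [hQ]
      rw [wirtinger_congr (wirtingerBar_eventuallyEq h2), wirtinger_wirtingerBar_norm_sq_sub]
      rfl
    -- A gap below `2/3` means `ρ > 1/3`, the range of `leviCoeff_nonneg`. Then `κ ≥ 0`, and `Q = 1`
    -- makes the coefficient at least `ε`, whatever the size of `ε`.
    have hg : ∀ᶠ q : ℂ × ℂ in 𝓝 (z₀, ζ₀), discGap (h q.1) q.2 < 2 / 3 :=
      hgap.eventually (gt_mem_nhds (show discGap (h z₀) ζ₀ < 2 / 3 by rw [hgap0]; norm_num))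
    refine ⟨1, one_pos, _, hΩ'.and (hQ1.and hg), fun ε hε _ ↦ ⟨min ε (1 / 2), by positivity, ?_⟩⟩
    rintro q ⟨h1, h2, h3⟩ h4
    have h5 := discGap_pos (hn _ h1) h4
    have h6 : 0 ≤ κ q := leviCoeff_nonneg _ _ (by linarith) (by linarith)
    refine key ε q _ h1 h4 h6 ((min_le_left _ _).trans ?_) (min_le_right _ _) (by positivity)
    rw [h2]
    linarith

/-- A smooth function with prescribed germs `|z - z₀|²` at finitely many points. -/
theorem exists_smooth_eventuallyEq_norm_sq {C : Type*} [TopologicalSpace C] [T2Space C]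
    [ChartedSpace ℂ C] [IsManifold 𝓘(ℂ) ω C] {F : Set C} (hF : F.Finite) :
    ∃ ψ : C → ℝ, ContMDiff 𝓘(ℝ, ℂ) 𝓘(ℝ, ℝ) ∞ ψ ∧
      ∀ x ∈ F, ψ =ᶠ[𝓝 x] fun y ↦ ‖chartAt ℂ x y - chartAt ℂ x x‖ ^ 2 := by
  obtain ⟨U, hU, hd⟩ := hF.t2_separation
  have hb : ∀ x, ∃ f : SmoothBumpFunction 𝓘(ℝ, ℂ) x, tsupport f ⊆ U x := fun x ↦ by
    obtain ⟨f, -, hf⟩ := (SmoothBumpFunction.nhds_basis_tsupport (I := 𝓘(ℝ, ℂ)) x).mem_iff.1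
      ((hU x).2.mem_nhds (hU x).1)
    exact ⟨f, hf⟩
  choose f hf using hb
  -- The bump functions have supports in disjoint neighbourhoods and equal `1` near their centres,
  -- so near each point of `F` a single summand survives.
  refine ⟨fun y ↦ ∑ x ∈ hF.toFinset, f x y • ‖chartAt ℂ x y - chartAt ℂ x x‖ ^ 2, ?_, ?_⟩
  · refine ContMDiff.sum fun x _ ↦ (f x).contMDiff_smul ?_
    have h1 : ContMDiffOn 𝓘(ℝ, ℂ) 𝓘(ℝ, ℂ) ∞ (chartAt ℂ x) (chartAt ℂ x).source :=
      contMDiffOn_of_mem_maximalAtlas (mem_maximalAtlas_real (chart_mem_atlas ℂ x) _)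
    have h2 : ContDiff ℝ ∞ fun z : ℂ ↦ ‖z - chartAt ℂ x x‖ ^ 2 :=
      (contDiff_id.sub contDiff_const).norm_sq ℝ
    exact h2.contMDiff.comp_contMDiffOn h1
  · intro x hx
    filter_upwards [(f x).eventuallyEq_one, (hU x).2.mem_nhds (hU x).1] with y h1 h2
    rw [Finset.sum_eq_single x]
    · rw [h1]; simp
    · intro x' hx' hne
      have : y ∉ tsupport (f x') := fun h ↦
        disjoint_left.1 (hd (hF.mem_toFinset.1 hx') hx hne) (hf x' h) h2
      rw [image_eq_zero_of_notMem_tsupport this, zero_smul]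
    · intro h
      exact absurd (hF.mem_toFinset.2 hx) h

/-! ### From chart estimates to the Levi form on `P` -/

section Levi

variable {E : Type*} [NormedAddCommGroup E] [NormedSpace ℂ E]
  {X : Type*} [TopologicalSpace X] [ChartedSpace E X]

/-- The Levi form at `x`, computed in the preferred chart at a nearby point `x₀`. -/
theorem leviForm_eq_flatLevi_transDeriv [IsManifold 𝓘(ℂ, E) ω X] {u : X → ℝ} {x₀ x : X}
    (hx : x ∈ (chartAt E x₀).source)
    (hu : ContDiffAt ℝ 2 (u ∘ (chartAt E x₀).symm) (chartAt E x₀ x)) (v w : E) :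
    leviForm u x v w = flatLevi (u ∘ (chartAt E x₀).symm) (chartAt E x₀ x)
      (transDeriv x₀ x v) (transDeriv x₀ x w) := by
  have hxx : (chartAt E x).symm (chartAt E x x) = x :=
    (chartAt E x).left_inv (mem_chart_source E x)
  have hval : (chartAt E x₀ ∘ (chartAt E x).symm) (chartAt E x x) = chartAt E x₀ x := by
    rw [Function.comp_apply, hxx]
  have hev : u ∘ (chartAt E x).symm =ᶠ[𝓝 (chartAt E x x)]
      (u ∘ (chartAt E x₀).symm) ∘ (chartAt E x₀ ∘ (chartAt E x).symm) := by
    have h1 : ContinuousAt (chartAt E x).symm (chartAt E x x) :=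
      (chartAt E x).continuousAt_symm ((chartAt E x).map_source (mem_chart_source E x))
    have h2 : ∀ᶠ y in 𝓝 (chartAt E x x), (chartAt E x).symm y ∈ (chartAt E x₀).source :=
      h1.eventually (by rw [hxx]; exact (chartAt E x₀).open_source.mem_nhds hx)
    filter_upwards [h2] with y hy
    simp only [Function.comp_apply]
    rw [(chartAt E x₀).left_inv hy]
  rw [leviForm_eq_flatLevi, flatLevi_congr hev,
    flatLevi_comp (contDiffAt_coordChange hx) (by rw [hval]; exact hu), hval]
  rfl

theorem isHermitianRe_leviForm {u : X → ℝ} {x : X}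
    (hu : ContDiffAt ℝ 2 (u ∘ (chartAt E x).symm) (chartAt E x x)) :
    IsHermitianRe (V := E) (leviForm u x) where
  symm v w := flatLevi_symm hu v w
  add_right v w w' := flatLevi_add_right _ _ v w w'
  smul_right v w c := by
    rw [Complex.coe_smul]
    exact flatLevi_smul_right _ _ v w c
  inv_I v w := flatLevi_I v w

end Levi

namespace DiscBundle

variable {ι : Type*} {C : Type*} [TopologicalSpace C] [ChartedSpace ℂ C] [IsManifold 𝓘(ℂ) ω C]
  {B : DiscBundle ι C} {s : C → B.P}

/-- The potential `-log (-r)` in a chart, at a point of `D`. -/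
theorem IsHarmonicSection.potential_chart_symm (hs : B.IsHarmonicSection s) {f : C → ℝ}
    {i : ι} {e : OpenPartialHomeomorph C ℂ} (he : e ∈ atlas ℂ C) {q : ℂ × ℂ}
    (hq : q ∈ (B.chart i e false).target) (hq2 : ‖q.2‖ < 1) :
    (fun x ↦ -Real.log (-B.definingFunction s f x)) ∘ (B.chart i e false).symm =ᶠ[𝓝 q] fun q ↦
      f (e.symm q.1) - Real.log (discGap (B.localRep s i e q.1) q.2) := by
  have hb := B.mem_chart_target_iff.1 hq
  have hne := one_sub_conj_mul_ne_zero (hs.1.sectionCoord_spec hb.2).1 hq2.le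
  have h1 : ∀ᶠ q' : ℂ × ℂ in 𝓝 q, ‖q'.2‖ < 1 :=
    (continuous_snd.norm.continuousAt (x := q)).eventually (gt_mem_nhds hq2)
  filter_upwards [hs.definingFunction_chart_symm (f := f) he hq hne,
    (B.chart i e false).open_target.mem_nhds hq, h1] with q' h2 h3 h4
  have h5 : discGap (B.localRep s i e q'.1) q'.2 ≠ 0 :=
    (discGap_pos (hs.1.sectionCoord_spec (B.mem_chart_target_iff.1 h3).2).1 h4).ne'
  simp only [Function.comp_apply] at h2 ⊢
  rw [h2, neg_neg, Real.log_mul (Real.exp_ne_zero _) h5, Real.log_exp]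
  ring

theorem IsHarmonicSection.contDiffAt_potential (hs : B.IsHarmonicSection s) {f : C → ℝ}
    (hf : ContMDiff 𝓘(ℝ, ℂ) 𝓘(ℝ, ℝ) 2 f)
    {i : ι} {e : OpenPartialHomeomorph C ℂ} (he : e ∈ atlas ℂ C) {q : ℂ × ℂ}
    (hq : q ∈ (B.chart i e false).target) (hq2 : ‖q.2‖ < 1) :
    ContDiffAt ℝ 2 ((fun x ↦ -Real.log (-B.definingFunction s f x)) ∘ (B.chart i e false).symm)
      q := by
  refine ContDiffAt.congr_of_eventuallyEq ?_ (hs.potential_chart_symm he hq hq2)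
  have hb := B.mem_chart_target_iff.1 hq
  have hh := (hs.1.sectionCoord_spec hb.2).1
  have a1 : ContDiffAt ℝ 2 (fun q : ℂ × ℂ ↦ f (e.symm q.1)) q :=
    ContDiffAt.comp (g := fun z ↦ f (e.symm z)) (f := Prod.fst) _
      (hf.contDiffAt_chart he hb.1) contDiffAt_fst
  have a2 : ContDiffAt ℝ 2 (fun q : ℂ × ℂ ↦ B.localRep s i e q.1) q :=
    ContDiffAt.comp (g := B.localRep s i e) (f := Prod.fst) _
      (hs.contDiffAt_localRep he hb) contDiffAt_fst
  exact a1.sub ((contDiffAt_discGap a2 contDiffAt_snd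
    (one_sub_conj_mul_ne_zero hh hq2.le)).log (discGap_pos hh hq2).ne')

/-- A point of `D` in the domain of an affine chart. -/
theorem norm_chart_snd_lt_one {i : ι} {e : OpenPartialHomeomorph C ℂ} {p : B.P}
    (hp : p ∈ (B.chart i e false).source) (hD : p ∈ B.D) : ‖(B.chart i e false p).2‖ < 1 := by
  obtain ⟨ζ, h1, h2⟩ := (B.mem_D_iff (B.mem_chart_source_iff.1 hp).1).1 hD
  rw [B.chart_apply, h2]
  exact h1

/-- The lower bound on the Levi form near a boundary point. -/
theorem IsHarmonicSection.exists_leviForm_bound (hs : B.IsHarmonicSection s) {ψ : C → ℝ}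
    (hψ : ContMDiff 𝓘(ℝ, ℂ) 𝓘(ℝ, ℝ) ∞ ψ)
    (hcrit : ∀ x, B.IsCriticalPoint s x →
      ψ =ᶠ[𝓝 x] fun y ↦ ‖chartAt ℂ x y - chartAt ℂ x x‖ ^ 2)
    (g : HermitianMetric (ℂ × ℂ) B.P) {p₀ : B.P} (hp₀ : p₀ ∈ frontier B.D) :
    ∃ ε₀ > 0, ∃ W ∈ 𝓝 p₀, ∀ ε, 0 < ε → ε < ε₀ → ∃ c > 0, ∀ p ∈ W, p ∈ B.D → ∀ v : ℂ × ℂ,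
      c * g.inner p v v ≤
        leviForm (fun x ↦ -Real.log (-B.definingFunction s (fun y ↦ ε * ψ y) x)) p v v := by
  obtain ⟨ζ₀, hζ₀, hfib⟩ := B.exists_norm_eq_one_of_mem_frontier hp₀
  have hch := B.chartAt_eq (p := p₀) (by rw [hfib]; exact OnePoint.coe_ne_infty _)
  set i := B.indexAt (B.proj p₀) with hi
  set x₀ := B.proj p₀ with hx₀
  set e := chartAt ℂ x₀ with he
  have heat : e ∈ atlas ℂ C := _root_.chart_mem_atlas ℂ _
  have hes : x₀ ∈ e.source := mem_chart_source ℂ _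
  have hφ₀ : B.chart i e false p₀ = (e x₀, ζ₀) := by
    rw [B.chart_apply, hfib]; rfl
  have hsrc : p₀ ∈ (chartAt (ℂ × ℂ) p₀).source := mem_chart_source _ _
  have hz₀ : e x₀ ∈ e.target ∩ e.symm ⁻¹' B.baseSet i := by
    refine ⟨e.map_source hes, ?_⟩
    rw [mem_preimage, e.left_inv hes]
    exact B.mem_baseSet_at _
  obtain ⟨ε₀, hε₀, W, hW, hmain⟩ := exists_flatLevi_bound (h := B.localRep s i e)
    (ψ := fun z ↦ ψ (e.symm z)) (e.isOpen_inter_preimage_symm (B.isOpen_baseSet i))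
    (fun z hz ↦ hs.contDiffAt_localRep heat hz) (hs.2 i e heat).2
    (fun z hz ↦ (hs.1.sectionCoord_spec hz.2).1) (fun z hz ↦ hψ.contDiffAt_chart heat hz.1)
    hz₀ hζ₀ (by
      -- Criticality of `x₀` is defined by exactly the coordinates in use, namely `indexAt x₀` and
      -- the preferred chart at `x₀`.
      by_cases hc : B.IsCriticalPoint s x₀
      · right
        have h1 : ContinuousAt e.symm (e x₀) := e.continuousAt_symm hz₀.1
        have h2 := h1.eventually (by rw [e.left_inv hes]; exact hcrit x₀ hc)
        filter_upwards [h2, e.open_target.mem_nhds hz₀.1] with z h3 h4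
        rw [h3, ← he, e.right_inv h4]
      · left
        exact not_not.1 hc)
  obtain ⟨A, hA, hgA⟩ := g.eventually_le p₀
  have hcont : ContinuousAt (chartAt (ℂ × ℂ) p₀) p₀ := (chartAt (ℂ × ℂ) p₀).continuousAt hsrc
  have hW' : ∀ᶠ p in 𝓝 p₀, chartAt (ℂ × ℂ) p₀ p ∈ W :=
    hcont.eventually (by rw [hch, hφ₀]; exact hW)
  refine ⟨ε₀, hε₀, _, hW'.and (hgA.and ((chartAt (ℂ × ℂ) p₀).open_source.mem_nhds hsrc)),
    fun ε hε hε' ↦ ?_⟩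
  obtain ⟨c, hc, hbound⟩ := hmain ε hε hε'
  refine ⟨c / A, by positivity, ?_⟩
  rintro p ⟨h1, h2, h3⟩ hpD v
  have h3' : p ∈ (B.chart i e false).source := hch ▸ h3
  have h4 := norm_chart_snd_lt_one h3' hpD
  have h5 := (B.chart i e false).map_source h3'
  have hf : ContMDiff 𝓘(ℝ, ℂ) 𝓘(ℝ, ℝ) 2 fun y ↦ ε * ψ y :=
    contMDiff_const.mul (hψ.of_le (WithTop.coe_le_coe.2 (le_top : (2 : ℕ∞) ≤ ⊤)))
  rw [leviForm_eq_flatLevi_transDeriv h3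
    (by rw [hch]; exact hs.contDiffAt_potential hf heat h5 h4), hch,
    flatLevi_congr (hs.potential_chart_symm heat h5 h4)]
  rw [hch] at h1
  refine le_trans ?_ (hbound _ h1 h4 _)
  -- The chart estimate is Euclidean in `transDeriv p₀ p v`; the local bound on `g` by `A` times
  -- that square converts it into an estimate by `g`.
  calc c / A * g.inner p v v ≤ c / A * (A * ‖transDeriv p₀ p v‖ ^ 2) := by gcongr; exact h2 v
    _ = c * ‖transDeriv p₀ p v‖ ^ 2 := by field_simp

theorem exists_hermitianMetric_P [T2Space C] [CompactSpace C] (B : DiscBundle ι C) :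
    Nonempty (HermitianMetric (ℂ × ℂ) B.P) := by
  let b : ℂ →L[ℝ] ℂ →L[ℝ] ℝ := innerSL ℝ
  let B₀ : ℂ × ℂ →L[ℝ] ℂ × ℂ →L[ℝ] ℝ :=
    b.bilinearComp (.fst ℝ ℂ ℂ) (.fst ℝ ℂ ℂ) + b.bilinearComp (.snd ℝ ℂ ℂ) (.snd ℝ ℂ ℂ)
  have hB : ∀ v w, B₀ v w = inner ℝ v.1 w.1 + inner ℝ v.2 w.2 := fun v w ↦ rfl
  refine exists_hermitianMetric B₀ (fun v w ↦ ?_) (fun v hv ↦ ?_) (fun v w ↦ ?_)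
  · rw [hB, hB, real_inner_comm, real_inner_comm v.2]
  · rw [hB, real_inner_self_eq_norm_sq, real_inner_self_eq_norm_sq]
    by_contra h
    have h1 : ‖v.1‖ = 0 := by nlinarith [sq_nonneg ‖v.1‖, sq_nonneg ‖v.2‖]
    have h2 : ‖v.2‖ = 0 := by nlinarith [sq_nonneg ‖v.1‖, sq_nonneg ‖v.2‖]
    exact hv (Prod.ext (norm_eq_zero.1 h1) (norm_eq_zero.1 h2))
  · rw [hB, hB]
    have h : ∀ a b : ℂ, inner ℝ (Complex.I • a) (Complex.I • b) = inner ℝ a b := fun a b ↦ by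
      simp [Complex.inner]
    rw [Prod.smul_fst, Prod.smul_snd, Prod.smul_fst, Prod.smul_snd, h, h]

/-- Strict positivity of the Levi form near the boundary. -/
theorem IsHarmonicSection.exists_leviForm_gt [T2Space C] [CompactSpace C]
    (hs : B.IsHarmonicSection s) (hcrit : {x | B.IsCriticalPoint s x}.Finite) :
    ∃ f : C → ℝ, ContMDiff 𝓘(ℝ, ℂ) 𝓘(ℝ, ℝ) 2 f ∧
      ∃ g : HermitianMetric (ℂ × ℂ) B.P, ∃ K : Set B.P, IsCompact K ∧ K ⊆ B.D ∧
        ∀ p ∈ B.D \ K, ∀ v : ℂ × ℂ, v ≠ 0 →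
          g.inner p v v < leviForm (fun x ↦ -Real.log (-B.definingFunction s f x)) p v v := by
  obtain ⟨ψ, hψ, hψF⟩ := exists_smooth_eventuallyEq_norm_sq hcrit
  obtain ⟨g⟩ := exists_hermitianMetric_P B
  have hloc := fun p₀ (hp₀ : p₀ ∈ frontier B.D) ↦ hs.exists_leviForm_bound hψ hψF g hp₀
  choose! ε₀ hε₀ W hW hbound using hloc
  obtain ⟨t, ht, hcover⟩ := (isClosed_frontier (s := B.D)).isCompact.elim_nhds_subcover
    (fun p ↦ interior (W p)) fun p hp ↦ interior_mem_nhds.2 (hW p hp)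
  -- A single weight must serve the whole boundary. With the finite cover already fixed, `ε` is
  -- taken below every `ε₀ p`, and only then do the constants `c p` become available.
  obtain ⟨ε, hε, hεt⟩ : ∃ ε > 0, ∀ p ∈ t, ε < ε₀ p := by
    have h1 : ∀ᶠ ε : ℝ in 𝓝[>] 0, ∀ p ∈ t, ε < ε₀ p := (Finset.eventually_all t).2 fun p hp ↦
      nhdsWithin_le_nhds (gt_mem_nhds (hε₀ p (ht p hp)))
    obtain ⟨ε, h2, h3⟩ := (h1.and self_mem_nhdsWithin).exists
    exact ⟨ε, h3, h2⟩
  have hb2 := fun p (hp : p ∈ t) ↦ hbound p (ht p hp) ε hε (hεt p hp)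
  choose! c hc hcb using hb2
  obtain ⟨δ, hδ, hδt⟩ : ∃ δ > 0, ∀ p ∈ t, δ < c p := by
    have h1 : ∀ᶠ δ : ℝ in 𝓝[>] 0, ∀ p ∈ t, δ < c p := (Finset.eventually_all t).2 fun p hp ↦
      nhdsWithin_le_nhds (gt_mem_nhds (hc p hp))
    obtain ⟨δ, h2, h3⟩ := (h1.and self_mem_nhdsWithin).exists
    exact ⟨δ, h3, h2⟩
  have hN : IsOpen (⋃ p ∈ t, interior (W p)) := isOpen_biUnion fun p _ ↦ isOpen_interior
  -- The metric is shrunk by `δ`, smaller than every `c p`, to make the inequality strict. The set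
  -- `K` is what the cover of the boundary leaves of the compact closure, so it lies inside `D`.
  refine ⟨fun y ↦ ε * ψ y, contMDiff_const.mul
    (hψ.of_le (WithTop.coe_le_coe.2 (le_top : (2 : ℕ∞) ≤ ⊤))), g.scale δ hδ,
    closure B.D \ ⋃ p ∈ t, interior (W p), (isClosed_closure.sdiff hN).isCompact, ?_, ?_⟩
  · rintro p ⟨h1, h2⟩
    rw [closure_eq_self_union_frontier] at h1
    exact h1.resolve_right fun h ↦ h2 (hcover h)
  · rintro p ⟨hpD, hpK⟩ v hv
    have h1 : p ∈ ⋃ p ∈ t, interior (W p) := by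
      by_contra h
      exact hpK ⟨subset_closure hpD, h⟩
    obtain ⟨p₀, h2, h3⟩ := mem_iUnion₂.1 h1
    refine lt_of_lt_of_le ?_ (hcb p₀ h2 p (interior_subset h3) hpD v)
    rw [g.scale_apply]
    exact mul_lt_mul_of_pos_right (hδt p₀ h2) (g.pos p v hv)

end DiscBundle

/-! ### Conclusion -/

theorem mainTheorem3 {C : Type*} [TopologicalSpace C] [T2Space C] [CompactSpace C]
    [ConnectedSpace C] [ChartedSpace ℂ C] [IsManifold 𝓘(ℂ) ω C] (hgenus : 2 ≤ genus C)
    {ι : Type*} (B : DiscBundle ι C) (s : C → B.P) (hs : B.IsHarmonicSection s)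
    (hcrit : {x | B.IsCriticalPoint s x}.Finite) :
    (∃ r : B.P → ℝ, IsDefiningFunction (ℂ × ℂ) B.D r ∧
      ∃ g : HermitianMetric (ℂ × ℂ) B.P, ∃ K : Set B.P, IsCompact K ∧ K ⊆ B.D ∧
        ∀ p ∈ B.D \ K, ∀ v : ℂ × ℂ, v ≠ 0 →
          g.inner p v v < leviForm (fun x ↦ -Real.log (-r x)) p v v) ∧
    TakeuchiConvex (ℂ × ℂ) 1 B.D := by
  obtain ⟨f, hf, g, K, hK, hKD, hlevi⟩ := hs.exists_leviForm_gt hcrit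
  refine ⟨⟨_, hs.isDefiningFunction hf, g, K, hK, hKD, hlevi⟩, B.isOpen_D, B.isConnected_D hs,
    isClosed_closure.isCompact, _, hs.isDefiningFunction hf, g, K, hK, hKD, fun p hp ↦ ?_⟩
  obtain ⟨ζ, -, hfib⟩ := hp.1
  have hch := B.chartAt_eq (p := p) (by rw [hfib]; exact OnePoint.coe_ne_infty _)
  have hsrc := mem_chart_source (ℂ × ℂ) p
  have hL := isHermitianRe_leviForm (E := ℂ × ℂ) (x := p)
    (u := fun x ↦ -Real.log (-B.definingFunction s f x)) (by
      rw [hch] at hsrc ⊢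
      exact hs.contDiffAt_potential hf (chart_mem_atlas ℂ _)
        ((B.chart _ _ false).map_source hsrc) (DiscBundle.norm_chart_snd_lt_one hsrc hp.1))
  -- For `q = 1` all `n` eigenvalues are required, so a full eigenbasis of the Levi form relative to
  -- `g` is taken. An eigenvalue at most `1` would contradict the strict inequality between the two
  -- forms on its eigenvector.
  obtain ⟨v, c, hv, hc⟩ := exists_basis_of_hermitianRe (g.isHermitianRe p)
    (fun v hv ↦ g.pos p v hv) hL
  rw [Nat.add_sub_cancel]
  refine ⟨v, hv, fun j ↦ ⟨c j, ?_, hc j⟩⟩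
  have h1 := hlevi p hp (v j) (hv.ne_zero j)
  rw [hc j (v j)] at h1
  have h2 : 0 < g.inner p (v j) (v j) := g.pos p (v j) (hv.ne_zero j)
  by_contra h
  exact absurd h1 (not_lt.2 (mul_le_of_le_one_left h2.le (not_lt.1 h)))
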